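/- **Model.** There are $N$ independent students and $p$ predictors, each either continuous or categorical with values $0,\dots,K_j$. For student $i$ the complete predictors are $Z_{ij}=F_j(Z^*_{ij})$, where $\mathbf Z^*_i\sim N(\mathbf 0,\boldsymbol\Sigma)$, $\boldsymbol\Sigma$ is a positive definite correlation matrix, and $F_j$ is $x\mapsto c_j+d_jx$ with $d_j>0$ (continuous) or maps $(c_{jk},c_{j,k+1}]$ to $k$ for strictly increasing cut points $c_{j1}<\dots<c_{jK_j}$, $c_{j0}=-\infty$, $c_{j,K_j+1}=\infty$ (categorical). The ability satisfies $\theta_i\mid \mathbf Z_i\sim N(\beta_0+\sum_j\boldsymbol\beta_j^\top g_j(Z_{ij}),\sigma^2)$, $\sigma^2>0$, where $g_j(z)=z$ for continuous $j$ and $g_j(z)=(\mathbb I\{z\ge1\},\dots,\mathbb I\{z\ge K_j\})^\top$ for categorical $j$. Given $\theta_i$ (and $\mathbf Z_i$), the responses $\mathbf Y_i=(Y_{il})_{l\in\mathcal B_i}$ to the assigned items are independent, $Y_{il}\in\{0,\dots,L_l\}$ following the generalised partial credit model $P(Y_{il}=k\mid\theta)\propto\exp\{\sum_{r=1}^k(a_l\theta+b_{lr})\}$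 with known item parameters (the two-parameter logistic model if $L_l=1$). The null predictors are those with $\boldsymbol\beta_j=\mathbf 0$; $\mathcal S^*$ is the set of the others. Let $\mathcal A_i\subset\{1,\dots,p\}$ be the random set of observed predictors of student $i$, $\mathbf Z_i^{\rm obs}=(Z_{ij})_{j\in\mathcal A_i}$ and $\mathbf Z^{\rm obs}_{i,-j}=(Z_{ik})_{k\in\mathcal A_i\setminus\{j\}}$. Given $\mathbf Z_i$, $\mathcal A_i$ is independent of $\mathbf Y_i$ and has a conditional probability mass function $q_i(\boldsymbol\alpha\mid\mathbf z)$ that depends on $\mathbf z$ only through $(z_k)_{k\in\boldsymbol\alpha\cap\mathcal S^*}$ (SMAR). Let $\mathbb P$ denote this model with the true parameters, and $\mathbb Q$ the model of the same form with fixed plug-in parameters $\hat{\boldsymbol\Sigma},\hat F_j,\hat\beta_0,\hat{\boldsymbol\beta}_j,\hat\sigma^2$ (same items). **Knockoffs under $\mathbb Q$.** For each student, given the observed data $(\mathcal A_i,\mathbf Z_i^{\rm obs},\mathbf Y_i)$, sample underlying variables $\mathbf U_i$ from the conditional distribution under $\mathbb Q$ of the underlying variables given $\mathbf Z^{\rm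 obs}_i$ and $\mathbf Y_i$; then sample $\tilde{\mathbf U}_i$ from the conditional distribution of the second block given that the first block equals $\mathbf U_i$ in the centred normal distribution with covariance $\begin{pmatrix}\hat{\boldsymbol\Sigma}&\hat{\boldsymbol\Sigma}-\mathbf S\\ \hat{\boldsymbol\Sigma}-\mathbf S&\hat{\boldsymbol\Sigma}\end{pmatrix}$, where $\mathbf S$ is a diagonal matrix for which this covariance is positive definite; put $\tilde Z_{ij}=\hat F_j(\tilde U_{ij})$ and $\tilde{\mathbf Z}^{\rm obs}_i=(\tilde Z_{ij})_{j\in\mathcal A_i}$, $\tilde{\mathbf Z}^{\rm obs}_{i,-j}=(\tilde Z_{ik})_{k\in\mathcal A_i\setminus\{j\}}$. **Selection.** Let $W_j$, $j=1,\dots,p$, be (measurable) knockoff statistics computed from the observed data and the knockoffs: for every set $\mathcal S$ of predictors, swapping the entries $Z_{ij}$ and $\tilde Z_{ij}$ for all $i$ and all $j\in\mathcal S\cap\mathcal A_i$ changes the sign of $W_j$ for $j\in\mathcal S$ and leaves $W_j$ unchanged for $j\notin\mathcal S$. For an integer $\nu\ge1$ let $\tau=\inf\{t>0:1+|\{j:W_j<-t\}|\le\nu\}$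 and $\hat{\mathcal S}=\{j:W_j>\tau\}$. **Observed KL divergence.** For $j\notin\mathcal S^*$ let $$\widehat{\mathrm{KL}}_j=\sum_{i:\,j\in\mathcal A_i}\log\frac{\mathbb P_{ij}(Z_{ij}\mid\mathbf Z^{\rm obs}_{i,-j},\mathbf Y_i)\,\mathbb Q_{ij}(\tilde{\mathbf Z}^{\rm obs}_{i,-j},\tilde Z_{ij}\mid\mathbf Z^{\rm obs}_{i,-j},Z_{ij},\mathbf Y_i)}{\mathbb P_{ij}(\tilde Z_{ij}\mid\mathbf Z^{\rm obs}_{i,-j},\mathbf Y_i)\,\mathbb Q_{ij}(\tilde{\mathbf Z}^{\rm obs}_{i,-j},Z_{ij}\mid\mathbf Z^{\rm obs}_{i,-j},\tilde Z_{ij},\mathbf Y_i)},$$ where $\mathbb P_{ij}(\cdot\mid\cdot)$ is the conditional density of $Z_{ij}$ under $\mathbb P$ and $\mathbb Q_{ij}(\cdot\mid\cdot)$ that of the observed knockoffs under $\mathbb Q$, for the given set $\mathcal A_i$ of observed predictors. **Theorem.** For every $\epsilon\ge0$, $$\mathbb E\,\bigl|\{j:\ j\in\hat{\mathcal S}\setminus\mathcal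 S^*\text{ and }\widehat{\mathrm{KL}}_j\le\epsilon\}\bigr|\le\nu e^{\epsilon}.$$ If $\mathbb Q=\mathbb P$, then $\widehat{\mathrm{KL}}_j=0$ for every null predictor $j\notin\mathcal S^*$. -/

import Mathlib

open MeasureTheory ProbabilityTheory
open scoped ENNReal NNReal

noncomputable section

namespace KnockoffIRT

/-! ### Predictors -/

/-- The type of a predictor.  A categorical predictor takes the values `0, …, K`;
it is binary if `K = 1` and ordinal if `K > 1`. -/
inductive PredictorKind where
  | continuous : PredictorKind
  | categorical (K : ℕ) : PredictorKind

/-- The dimension of the slope parameter of a predictor: `1` for a continuous one, the number `K`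
of dummy variables for a categorical one with values `0, …, K`. -/
def PredictorKind.dim : PredictorKind → ℕ
  | .continuous => 1
  | .categorical K => K

/-- The regressors `g(z)` of a predictor: `z` itself if it is continuous, and the dummies
`(𝟙{z ≥ 1}, …, 𝟙{z ≥ K})` if it is categorical (for a binary predictor this is again `z`). -/
def PredictorKind.regressor : (κ : PredictorKind) → ℝ → Fin κ.dim → ℝ
  | .continuous, z, _ => z
  | .categorical _, z, k => if ((k : ℕ) : ℝ) + 1 ≤ z then 1 else 0

/-- The marginal transformation of a predictor in the copula model: an increasing affine map, or
strictly increasing cut points `c₁ < ⋯ < c_K`. -/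
inductive Transform : PredictorKind → Type
  | affine (c d : ℝ) (hd : 0 < d) : Transform .continuous
  | cuts {K : ℕ} (c : Fin K → ℝ) (hc : StrictMono c) : Transform (.categorical K)

/-- The predictor as a function of its underlying variable: `c + d x`, respectively the `k` with
`c_k < x ≤ c_{k+1}` (where `c₀ = -∞`, `c_{K+1} = ∞`), which is the number of cut points below
`x`. -/
def Transform.toFun : {κ : PredictorKind} → Transform κ → ℝ → ℝ
  | _, .affine c d _, x => c + d * x
  | _, .cuts c _, x => ((Finset.univ.filter fun k => c k < x).card : ℝ)

/-- The fibre of the transformation over the value `z`, as a measure on the underlying real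
variable: integrating against it turns a density of the underlying variable into a density of the
predictor (with respect to Lebesgue measure, respectively counting measure). -/
def Transform.fibre : {κ : PredictorKind} → Transform κ → ℝ → Measure ℝ
  | _, .affine c d _, z => ENNReal.ofReal d⁻¹ • Measure.dirac ((z - c) / d)
  | _, .cuts c hc, z => volume.restrict {x | (Transform.cuts c hc).toFun x = z}

/-! ### Multivariate normal densities -/

/-- The density of the (nondegenerate) multivariate normal distribution `N(0, V)`. -/
def normalDensity {n : Type*} [Fintype n] [DecidableEq n] (V : Matrix n n ℝ) (x : n → ℝ) : ℝ≥0∞ :=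
  ENNReal.ofReal ((Real.sqrt ((2 * Real.pi) ^ Fintype.card n * V.det))⁻¹ *
    Real.exp (-(x ⬝ᵥ V⁻¹.mulVec x) / 2))

/-- The joint covariance matrix `[[V, V - S], [V - S, V]]`, `S = diag s`, of the underlying
variables and their knockoffs. -/
def jointCov {p : ℕ} (V : Matrix (Fin p) (Fin p) ℝ) (s : Fin p → ℝ) :
    Matrix (Fin p ⊕ Fin p) (Fin p ⊕ Fin p) ℝ :=
  Matrix.fromBlocks V (V - Matrix.diagonal s) (V - Matrix.diagonal s) V

/-! ### Measurement model -/

/-- Item-specific parameters.  Item `l` has the categories `0, …, K l`. -/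
structure Items (ι : Type*) where
  /-- the largest category -/
  K : ι → ℕ
  /-- the discriminations -/
  a : ι → ℝ
  /-- the intercepts `b_{l1}, …, b_{l K_l}` (other indices are irrelevant) -/
  b : ι → ℕ → ℝ

/-- The generalised partial credit model: the probability of response `k` to item `l` at ability
`t`.  If `K l = 1` this is the two-parameter logistic model. -/
def Items.prob {ι : Type*} (I : Items ι) (l : ι) (t : ℝ) (k : ℕ) : ℝ :=
  Real.exp (∑ r ∈ Finset.Icc 1 k, (I.a l * t + I.b l r)) /
    ∑ m ∈ Finset.range (I.K l + 1), Real.exp (∑ r ∈ Finset.Icc 1 m, (I.a l * t + I.b l r))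

/-- The possible responses of a student to the set `B` of assigned items. -/
abbrev Items.Resp {ι : Type*} (I : Items ι) (B : Finset ι) : Type _ :=
  (l : {l // l ∈ B}) → Fin (I.K l + 1)

/-- The probability of the response vector `y` at ability `t` (local independence). -/
def Items.respProb {ι : Type*} (I : Items ι) {B : Finset ι} (t : ℝ) (y : I.Resp B) : ℝ≥0∞ :=
  ∏ l : {l // l ∈ B}, ENNReal.ofReal (I.prob l t (y l))

/-! ### Parameters of the latent regression model with Gaussian copula predictors -/

/-- The parameters of the Gaussian copula model (nondegenerate correlation matrix and
transformations) and of the structural model (intercept, slopes, residual variance). -/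
structure Params {p : ℕ} (kind : Fin p → PredictorKind) where
  /-- the correlation matrix of the underlying variables -/
  corr : Matrix (Fin p) (Fin p) ℝ
  corr_posDef : corr.PosDef
  corr_diag : ∀ j, corr j j = 1
  /-- the marginal transformations -/
  transf : (j : Fin p) → Transform (kind j)
  /-- the intercept -/
  intercept : ℝ
  /-- the slopes -/
  slope : (j : Fin p) → Fin (kind j).dim → ℝ
  /-- the residual variance -/
  resVar : ℝ≥0
  resVar_pos : 0 < resVar

section Model

variable {p : ℕ} {kind : Fin p → PredictorKind} {ι : Type*}

/-- The non-null predictors: those with a nonzero slope vector. -/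
def Params.nonNull (M : Params kind) : Set (Fin p) := {j | M.slope j ≠ 0}

/-- The complete predictors as a function of the underlying variables. -/
def Params.predictors (M : Params kind) (x : Fin p → ℝ) : Fin p → ℝ :=
  fun j => (M.transf j).toFun (x j)

/-- The conditional mean of the ability given the complete predictors. -/
def Params.abilityMean (M : Params kind) (z : Fin p → ℝ) : ℝ :=
  M.intercept + ∑ j, ∑ k, M.slope j k * (kind j).regressor (z j) k

/-- The conditional probability of the responses `y` given the complete predictors `z`. -/
def Params.respDensity (M : Params kind) (I : Items ι) {B : Finset ι} (y : I.Resp B)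
    (z : Fin p → ℝ) : ℝ≥0∞ :=
  ∫⁻ t, I.respProb t y ∂(gaussianReal (M.abilityMean z) M.resVar)

/-- The measure on the underlying variables that integrates them over the fibre of `z j` for each
observed predictor `j ∈ α`, and over the whole line for each missing one. -/
def Params.fibre (M : Params kind) (α : Finset (Fin p)) (z : Fin p → ℝ) : Measure (Fin p → ℝ) :=
  Measure.pi fun j => if j ∈ α then (M.transf j).fibre (z j) else volume

/-- The joint density of `(Z_j)_{j ∈ α}` and `Y` at `((z j)_{j ∈ α}, y)`. -/
def Params.obsDensity (M : Params kind) (I : Items ι) {B : Finset ι} (α : Finset (Fin p))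
    (z : Fin p → ℝ) (y : I.Resp B) : ℝ≥0∞ :=
  ∫⁻ x, normalDensity M.corr x * M.respDensity I y (M.predictors x) ∂(M.fibre α z)

/-- The joint density of `(Z_j)_{j ∈ α}`, the knockoffs `(Z̃_j)_{j ∈ α}` and `Y`, under the model
in which the underlying variables have covariance `jointCov corr s` and `Z̃` is conditionally
independent of `Y` given `Z`. -/
def Params.jointDensity (M : Params kind) (s : Fin p → ℝ) (I : Items ι) {B : Finset ι}
    (α : Finset (Fin p)) (z zt : Fin p → ℝ) (y : I.Resp B) : ℝ≥0∞ :=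
  ∫⁻ x, ∫⁻ xt, normalDensity (jointCov M.corr s) (Sum.elim x xt) *
    M.respDensity I y (M.predictors x) ∂(M.fibre α zt) ∂(M.fibre α z)

/-- The conditional density of `Z_j` at `z j` given `(Z_k)_{k ∈ α \ {j}}` and `Y`. -/
def Params.condDensity (M : Params kind) (I : Items ι) {B : Finset ι} (α : Finset (Fin p))
    (j : Fin p) (z : Fin p → ℝ) (y : I.Resp B) : ℝ≥0∞ :=
  M.obsDensity I α z y / M.obsDensity I (α.erase j) z y

/-- The conditional density of the knockoffs `(Z̃_k)_{k ∈ α}` at `zt` given `(Z_k)_{k ∈ α}`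
and `Y`. -/
def Params.knockoffDensity (M : Params kind) (s : Fin p → ℝ) (I : Items ι) {B : Finset ι}
    (α : Finset (Fin p)) (z zt : Fin p → ℝ) (y : I.Resp B) : ℝ≥0∞ :=
  M.jointDensity s I α z zt y / M.obsDensity I α z y

/-- The observed Kullback-Leibler divergence of predictor `j`, for the true model `P`, the plug-in
model `Q` (knockoffs constructed with the diagonal matrix `diag s`), and data of `N` students with
assigned items `B i`, observed predictors `A i`, predictors `z i`, knockoffs `zt i` and responses
`y i`. -/
def klHat (P Q : Params kind) (s : Fin p → ℝ) (I : Items ι) {N : ℕ} (B : Fin N → Finset ι)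
    (A : Fin N → Finset (Fin p)) (z zt : Fin N → Fin p → ℝ) (y : (i : Fin N) → I.Resp (B i))
    (j : Fin p) : ℝ :=
  ∑ i ∈ Finset.univ.filter (fun i => j ∈ A i), Real.log
    ((P.condDensity I (A i) j (z i) (y i) *
        Q.knockoffDensity s I (A i) (z i) (zt i) (y i)) /
      (P.condDensity I (A i) j (Function.update (z i) j (zt i j)) (y i) *
        Q.knockoffDensity s I (A i) (Function.update (z i) j (zt i j))
          (Function.update (zt i) j (z i j)) (y i))).toReal

/-! ### Generation of the knockoffs -/

/-- The conditional distribution of the underlying variables given `(Z_j)_{j ∈ α} = (z j)_{j ∈ α}`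
and `Y = y`. -/
def Params.latentPosterior (M : Params kind) (I : Items ι) {B : Finset ι} (α : Finset (Fin p))
    (z : Fin p → ℝ) (y : I.Resp B) : Measure (Fin p → ℝ) :=
  (M.obsDensity I α z y)⁻¹ • (M.fibre α z).withDensity
    (fun x => normalDensity M.corr x * M.respDensity I y (M.predictors x))

/-- The conditional distribution of `xt` given `x`, if `(x, xt)` is normal with mean zero and
covariance `jointCov corr s`. -/
def Params.knockoffKernel (M : Params kind) (s x : Fin p → ℝ) : Measure (Fin p → ℝ) :=
  volume.withDensity
    (fun xt => normalDensity (jointCov M.corr s) (Sum.elim x xt) / normalDensity M.corr x)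

/-- The observed part of `z`: the entries outside `α` are replaced by `0`. -/
def mask (α : Finset (Fin p)) (z : Fin p → ℝ) : Fin p → ℝ := fun j => if j ∈ α then z j else 0

end Model

/-- `κ` is (a version of) the conditional distribution of `X` given `D`. -/
def HasCondLaw {Ω E F : Type*} [MeasurableSpace Ω] [MeasurableSpace E] [StandardBorelSpace E]
    [Nonempty E] [MeasurableSpace F] (X : Ω → E) (D : Ω → F) (κ : F → Measure E)
    (μ : Measure Ω) [IsFiniteMeasure μ] : Prop :=
  ∀ᵐ d ∂(μ.map D), condDistrib X D μ d = κ d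

/-- The stronger missing-at-random condition with respect to the set `S` of predictors, for the
conditional probability mass function `q · z` of the set of observed predictors given `Z = z`. -/
def SMAR {p : ℕ} (S : Set (Fin p)) (q : (Fin p → ℝ) → PMF (Finset (Fin p))) : Prop :=
  ∀ (α : Finset (Fin p)) (z z' : Fin p → ℝ),
    (∀ k ∈ α, k ∈ S → z k = z' k) → q z α = q z' α

/-- The data of `N` independent students under the true model `P`, and the knockoffs that are
generated from them under the plug-in model `Q`.  For student `i`, `X i` are the underlying
variables, `Θ i` is the ability, `Y i` are the responses to the assigned items `B i`, and `A i` is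
the set of observed predictors; `Xs i` and `Xt i` are the underlying variables and their knockoffs
that are sampled in the construction of the knockoffs. -/
structure IsPlugInKnockoffData {Ω : Type*} [MeasurableSpace Ω] (μ : Measure Ω)
    [IsProbabilityMeasure μ] {p N : ℕ} {kind : Fin p → PredictorKind} {ι : Type*}
    (I : Items ι) (B : Fin N → Finset ι) (P Q : Params kind) (s : Fin p → ℝ)
    (q : Fin N → (Fin p → ℝ) → PMF (Finset (Fin p)))
    (X : Fin N → Ω → Fin p → ℝ) (Θ : Fin N → Ω → ℝ) (Y : (i : Fin N) → Ω → I.Resp (B i))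
    (A : Fin N → Ω → Finset (Fin p)) (Xs Xt : Fin N → Ω → Fin p → ℝ) : Prop where
  measurable_X : ∀ i, Measurable (X i)
  measurable_Θ : ∀ i, Measurable (Θ i)
  measurable_Y : ∀ i, Measurable (Y i)
  measurable_A : ∀ i, Measurable (A i)
  measurable_Xs : ∀ i, Measurable (Xs i)
  measurable_Xt : ∀ i, Measurable (Xt i)
  /-- different students are independent -/
  indep : iIndepFun (fun i ω => (X i ω, Θ i ω, Y i ω, A i ω, Xs i ω, Xt i ω)) μ
  /-- Gaussian copula model -/
  law_X : ∀ i, μ.map (X i) = volume.withDensity (normalDensity P.corr)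
  /-- structural model, given the complete predictors -/
  law_Θ : ∀ i, HasCondLaw (Θ i) (fun ω => P.predictors (X i ω))
    (fun z => gaussianReal (P.abilityMean z) P.resVar) μ
  /-- measurement model, given the ability (and the complete predictors) -/
  law_Y : ∀ i, HasCondLaw (Y i) (fun ω => (P.predictors (X i ω), Θ i ω))
    (fun d => Measure.count.withDensity (fun y => I.respProb d.2 y)) μ
  /-- missingness: `q i` is the conditional probability mass function of `A i` given the complete
  predictors, and `A i` is conditionally independent of `Y i` given the complete predictors -/
  law_A : ∀ i, HasCondLaw (A i) (fun ω => (P.predictors (X i ω), Y i ω))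
    (fun d => (q i d.1).toMeasure) μ
  /-- underlying variables are sampled under `Q` given the observed data -/
  law_Xs : ∀ i, HasCondLaw (Xs i) (fun ω => (A i ω, mask (A i ω) (P.predictors (X i ω)), Y i ω))
    (fun d => Q.latentPosterior I d.1 d.2.1 d.2.2) μ
  /-- knockoffs of the underlying variables are sampled under `Q` -/
  law_Xt : ∀ i, HasCondLaw (Xt i)
    (fun ω => ((A i ω, mask (A i ω) (P.predictors (X i ω)), Y i ω), Xs i ω))
    (fun d => Q.knockoffKernel s d.2) μ

/-! ### Knockoff statistics and selection -/

/-- `z` with the columns `j ∈ S` replaced by those of `zt`. -/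
def swapCols {p N : ℕ} (S : Set (Fin p)) [DecidablePred (· ∈ S)] (z zt : Fin N → Fin p → ℝ) :
    Fin N → Fin p → ℝ :=
  fun i j => if j ∈ S then zt i j else z i j

/-- The statistic `w j`, a function of the missingness pattern `A`, the observed predictors, the
observed knockoffs and the responses, has the flip-sign property for every `j`. -/
def IsKnockoffStatistic {p N : ℕ} {R : Type*}
    (w : Fin p → (Fin N → Finset (Fin p)) → (Fin N → Fin p → ℝ) → (Fin N → Fin p → ℝ) → R → ℝ) :
    Prop :=
  ∀ (j : Fin p) (S : Finset (Fin p)) (A : Fin N → Finset (Fin p)) (z zt : Fin N → Fin p → ℝ)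
    (y : R),
    w j A (fun i => mask (A i) (swapCols S z zt i)) (fun i => mask (A i) (swapCols S zt z i)) y =
      if j ∈ S then -w j A (fun i => mask (A i) (z i)) (fun i => mask (A i) (zt i)) y
      else w j A (fun i => mask (A i) (z i)) (fun i => mask (A i) (zt i)) y

/-- The threshold `τ = inf {t > 0 : 1 + |{j : W j < -t}| ≤ ν}`. -/
def threshold {p : ℕ} (ν : ℕ) (W : Fin p → ℝ) : ℝ :=
  sInf {t : ℝ | 0 < t ∧ 1 + (Finset.univ.filter fun j => W j < -t).card ≤ ν}

/-- The selected predictors `{j : W j > τ}`. -/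
def selected {p : ℕ} (ν : ℕ) (W : Fin p → ℝ) : Set (Fin p) := {j | threshold ν W < W j}

/-- If the count `1 + |{j : W j < -t}|` attains the value `ν`, the threshold is the infimum of the
`t > 0` at which it does. -/
theorem threshold_eq_sInf_eq {p : ℕ} (ν : ℕ) (W : Fin p → ℝ)
    (h : {t : ℝ | 0 < t ∧ 1 + (Finset.univ.filter fun j => W j < -t).card = ν}.Nonempty) :
    threshold ν W =
      sInf {t : ℝ | 0 < t ∧ 1 + (Finset.univ.filter fun j => W j < -t).card = ν} := by
  obtain ⟨t₀, ht₀, hc₀⟩ := h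
  have bdd (S : ℕ → Prop) :
      BddBelow {t : ℝ | 0 < t ∧ S (1 + (Finset.univ.filter fun j => W j < -t).card)} :=
    ⟨0, fun t ht => le_of_lt ht.1⟩
  unfold threshold
  apply le_antisymm
  · exact csInf_le_csInf (bdd fun n => n ≤ ν) ⟨t₀, ht₀, hc₀⟩ fun t ht => ⟨ht.1, ht.2.le⟩
  · refine le_csInf ⟨t₀, ht₀, hc₀.le⟩ fun t ht => ?_
    by_cases hle : t₀ ≤ t
    · exact (csInf_le (bdd fun n => n = ν) ⟨ht₀, hc₀⟩).trans hle
    · refine csInf_le (bdd fun n => n = ν) ⟨ht.1, le_antisymm ht.2 ?_⟩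
      rw [← hc₀]
      refine Nat.add_le_add_left (Finset.card_le_card fun j hj => ?_) 1
      simp only [Finset.mem_filter, Finset.mem_univ, true_and] at hj ⊢
      linarith [not_le.mp hle]

end KnockoffIRT

end

/-! The proof compares the law of the data with its image under the exchange of one null predictor
and its knockoff.

The observed data of one student are the missingness pattern, the masked predictors, the masked
knockoffs and the responses. `map_studentData` shows that they have the density `dataDensity`: the
missingness probability, times the density of the observed predictors and responses under `P`, times
the conditional density of the knockoffs under `Q`. The reference measure does not change when `Z_j`
and its knockoff are exchanged (`measurePreserving_swapData`). For a null `j` the missingness factor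
does not change either, by SMAR, and the density of the remaining predictors and responses cancels.
Hence the likelihood ratio between the data of all students and the exchanged data is exactly `exp
(klHat …)` (`prod_dataDensity_eq_exp_klHat_mul`).

The exchange flips the sign of `W_j` and fixes the other statistics. It therefore preserves the
event `ExceedsThreshold`, which involves `W_j` only through `|W_j|` and which for `W_j > 0` says
that `j` is selected. A change of variables (`pi_withDensity_le_of_measurePreserving`) gives, for
each null `j`, P(j selected, KL_j ≤ ε) ≤ e^ε P(W_j < 0, `ExceedsThreshold`). In the sum over `j` the
right-hand side is e^ε times the expected number of negative statistics exceeding their modified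
thresholds. That number is at most `ν` for every realisation (`card_neg_and_exceedsThreshold_le`),
so no independence between the signs is needed.

If `Q = P`, the densities of predictors and knockoffs multiply to the joint density of a genuine
Gaussian knockoff model. This is invariant under exchanging a null coordinate, because the joint
covariance is and because the responses do not depend on that predictor
(`Params.jointDensity_swapPair`). So every likelihood ratio is one.

Much of the remaining work treats continuous, categorical and missing predictors together. The
fibres of the copula transformations are measures on the underlying variables that disintegrate
Lebesgue measure (`Params.lintegral_lintegral_fibre`). -/

noncomputable section

namespace KnockoffIRT

/-! ### Product measures -/

/-- Integrate out one coordinate at a time with `lmarginal`. Marginals are evaluated at a base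
point, so the empty product space is treated separately. -/
theorem lintegral_pi_prod {ι : Type*} [Fintype ι] {E : ι → Type*}
    [∀ i, MeasurableSpace (E i)] (μ : ∀ i, Measure (E i)) [∀ i, SigmaFinite (μ i)]
    {f : ∀ i, E i → ℝ≥0∞} (hf : ∀ i, Measurable (f i)) :
    ∫⁻ x, ∏ i, f i (x i) ∂(Measure.pi μ) = ∏ i, ∫⁻ t, f i t ∂(μ i) := by
  classical
  rcases isEmpty_or_nonempty (∀ i, E i) with h | ⟨⟨x₀⟩⟩
  · obtain ⟨i, hi⟩ := isEmpty_pi.mp h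
    rw [lintegral_of_isEmpty]
    exact (Finset.prod_eq_zero (Finset.mem_univ i) (lintegral_of_isEmpty _ _)).symm
  have key (s : Finset ι) (g : (∀ i, E i) → ℝ≥0∞) (hg : g = fun x => ∏ i ∈ s, f i (x i)) :
      ∀ x, (∫⋯∫⁻_s, g ∂μ) x = ∏ i ∈ s, ∫⁻ t, f i t ∂(μ i) := by
    induction s using Finset.induction_on generalizing g with
    | empty => intro x; simp [hg]
    | insert i s his ih =>
      intro x
      have hm : Measurable g := by
        rw [hg]
        exact Finset.measurable_prod _ fun i _ => (hf i).comp (measurable_pi_apply i)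
      rw [lmarginal_insert' g hm his]
      have : (fun x => ∫⁻ t, g (Function.update x i t) ∂(μ i)) =
          fun x => (∫⁻ t, f i t ∂(μ i)) * ∏ k ∈ s, f k (x k) := by
        funext x
        rw [← lintegral_mul_const _ (hf i)]
        refine lintegral_congr fun t => ?_
        rw [hg]
        simp only
        rw [Finset.prod_insert his, Function.update_self]
        congr 1
        refine Finset.prod_congr rfl fun k hk => ?_
        rw [Function.update_of_ne (by rintro rfl; exact his hk)]
      rw [this, Finset.prod_insert his, ← ih _ rfl x]
      simp only [lmarginal]
      rw [lintegral_const_mul]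
      refine Finset.measurable_prod _ fun k hk => (hf k).comp ?_
      exact (measurable_pi_apply k).comp measurable_updateFinset
  rw [lintegral_eq_lmarginal_univ x₀]
  exact key Finset.univ _ rfl x₀

theorem pi_withDensity {ι : Type*} [Fintype ι] {E : ι → Type*}
    [∀ i, MeasurableSpace (E i)] (μ : ∀ i, Measure (E i)) [∀ i, SigmaFinite (μ i)]
    {f : ∀ i, E i → ℝ≥0∞} (hf : ∀ i, Measurable (f i))
    [∀ i, SigmaFinite ((μ i).withDensity (f i))] :
    Measure.pi (fun i => (μ i).withDensity (f i)) =
      (Measure.pi μ).withDensity fun x => ∏ i, f i (x i) := by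
  refine Measure.pi_eq fun s hs => ?_
  rw [withDensity_apply _ (MeasurableSet.univ_pi hs), Measure.restrict_pi_pi,
    lintegral_pi_prod _ hf]
  exact Finset.prod_congr rfl fun i _ => (withDensity_apply _ (hs i)).symm

theorem lintegral_withDensity_mul {E : Type*} [MeasurableSpace E] (μ : Measure E)
    {f g : E → ℝ≥0∞} (hf : Measurable f) (hg : Measurable g) :
    ∫⁻ x, g x ∂(μ.withDensity f) = ∫⁻ x, f x * g x ∂μ :=
  lintegral_withDensity_eq_lintegral_mul μ hf hg

/-- The exchange of coordinate `j` between two vectors. -/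
def swapPair {n : Type*} [DecidableEq n] {E : Type*} (j : n) (x : (n → E) × (n → E)) :
    (n → E) × (n → E) :=
  (Function.update x.1 j (x.2 j), Function.update x.2 j (x.1 j))

theorem measurable_swapPair {n : Type*} [DecidableEq n] {E : Type*} [MeasurableSpace E] (j : n) :
    Measurable (swapPair j : (n → E) × (n → E) → _) := by
  unfold swapPair
  refine Measurable.prodMk ?_ ?_
  · refine measurable_pi_lambda _ fun k => ?_
    by_cases h : k = j
    · subst h; simpa [Function.comp_def] using (measurable_pi_apply k).comp measurable_snd
    · simpa [Function.update_of_ne h, Function.comp_def] using (measurable_pi_apply k).comp measurable_fst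
  · refine measurable_pi_lambda _ fun k => ?_
    by_cases h : k = j
    · subst h; simpa [Function.comp_def] using (measurable_pi_apply k).comp measurable_fst
    · simpa [Function.update_of_ne h, Function.comp_def] using (measurable_pi_apply k).comp measurable_snd

theorem sumElim_swapPair {n : Type*} [DecidableEq n] {E : Type*} (j : n)
    (x : (n → E) × (n → E)) :
    Sum.elim (swapPair j x).1 (swapPair j x).2 =
      Sum.elim x.1 x.2 ∘ Equiv.swap (Sum.inl j) (Sum.inr j) := by
  funext k
  rcases k with k | k <;> by_cases h : k = j
  · subst h; simp [swapPair]
  · simp [swapPair, h, Equiv.swap_apply_of_ne_of_ne]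
  · subst h; simp [swapPair]
  · simp [swapPair, h, Equiv.swap_apply_of_ne_of_ne]

/-- A pair of vectors is one vector indexed by `n ⊕ n`, and the exchange is reindexing by a
transposition, which only permutes the factors of a product measure. -/
theorem map_swapPair {n : Type*} [Fintype n] [DecidableEq n] {E : Type*} [MeasurableSpace E]
    (j : n) (μ ν : n → Measure E) [∀ i, SigmaFinite (μ i)] [∀ i, SigmaFinite (ν i)] :
    ((Measure.pi μ).prod (Measure.pi ν)).map (swapPair j) =
      (Measure.pi (Function.update μ j (ν j))).prod (Measure.pi (Function.update ν j (μ j))) := by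
  have hμ : ∀ i, SigmaFinite (Function.update μ j (ν j) i) := fun i => by
    by_cases h : i = j
    · subst h; simp; infer_instance
    · simp [h]; infer_instance
  have hν : ∀ i, SigmaFinite (Function.update ν j (μ j) i) := fun i => by
    by_cases h : i = j
    · subst h; simp; infer_instance
    · simp [h]; infer_instance
  let e : n ⊕ n ≃ n ⊕ n := Equiv.swap (Sum.inl j) (Sum.inr j)
  let ρ : n ⊕ n → Measure E := Sum.elim μ ν
  let ρ' : n ⊕ n → Measure E :=
    Sum.elim (Function.update μ j (ν j)) (Function.update ν j (μ j))
  have hρ : ∀ i, SigmaFinite (ρ i) := fun i => by rcases i with i | i <;> simp [ρ] <;> infer_instance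
  have hρ' : ∀ i, SigmaFinite (ρ' i) := fun i => by
    rcases i with i | i
    exacts [hμ i, hν i]
  have hρe : ρ' = ρ ∘ e := sumElim_swapPair j (μ, ν)
  have hee : (fun i => ρ' (e i)) = ρ := by
    funext i
    simp only [hρe, Function.comp, e, Equiv.swap_apply_self]
  have h1 := measurePreserving_sumPiEquivProdPi_symm ρ
  have h2 := measurePreserving_piCongrLeft ρ' e
  have h3 := measurePreserving_sumPiEquivProdPi ρ'
  rw [hee] at h2
  have h := (h3.comp (h2.comp h1)).map_eq
  simp only [ρ, ρ', Sum.elim_inl, Sum.elim_inr] at h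
  rw [← h]
  congr 1
  funext x
  have hx : (MeasurableEquiv.piCongrLeft (fun _ : n ⊕ n => E) e)
      ((MeasurableEquiv.sumPiEquivProdPi fun _ : n ⊕ n => E).symm x) =
      Sum.elim (swapPair j x).1 (swapPair j x).2 := by
    rw [sumElim_swapPair]
    funext k
    obtain ⟨k, rfl⟩ := e.surjective k
    rw [MeasurableEquiv.coe_piCongrLeft, Equiv.piCongrLeft_apply_apply]
    simp only [Function.comp, e, Equiv.swap_apply_self]
    rcases k with k | k <;> simp [MeasurableEquiv.sumPiEquivProdPi, Equiv.sumPiEquivProdPi]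
  simp only [Function.comp]
  rw [hx]
  rfl

/-! ### Conditional distributions -/

theorem HasCondLaw.lintegral_eq {Ω E F : Type*} [MeasurableSpace Ω] [MeasurableSpace E]
    [StandardBorelSpace E] [Nonempty E] [MeasurableSpace F] {X : Ω → E} {D : Ω → F}
    {κ : F → Measure E} {μ : Measure Ω} [IsFiniteMeasure μ] (h : HasCondLaw X D κ μ)
    (hX : Measurable X) (hD : Measurable D) {g : F × E → ℝ≥0∞} (hg : Measurable g) :
    ∫⁻ ω, g (D ω, X ω) ∂μ = ∫⁻ ω, ∫⁻ x, g (D ω, x) ∂(κ (D ω)) ∂μ := by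
  have h1 : ∫⁻ ω, g (D ω, X ω) ∂μ = ∫⁻ a, g a ∂(μ.map fun ω => (D ω, X ω)) :=
    (lintegral_map hg (hD.prodMk hX)).symm
  rw [h1, ← compProd_map_condDistrib hX.aemeasurable, Measure.lintegral_compProd hg,
    lintegral_map (hg.lintegral_kernel_prod_right') hD]
  refine lintegral_congr_ae ?_
  filter_upwards [ae_of_ae_map hD.aemeasurable h] with ω hω
  rw [hω]

/-! ### Normal densities -/

section Normal

variable {n : Type*} [Fintype n]

/-- The quadratic form attains a positive minimum on the compact unit sphere; homogeneity extends
the bound to all vectors. -/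
theorem exists_mul_sum_sq_le_of_posDef {V : Matrix n n ℝ} (hV : V.PosDef) :
    ∃ c : ℝ, 0 < c ∧ ∀ x : n → ℝ, c * ∑ i, x i ^ 2 ≤ x ⬝ᵥ V.mulVec x := by
  have hcont : Continuous fun x : n → ℝ => x ⬝ᵥ V.mulVec x := by fun_prop
  rcases isEmpty_or_nonempty n with hn | hn
  · exact ⟨1, one_pos, fun x => by simp [dotProduct]⟩
  obtain ⟨x₀, hx₀, hmin⟩ := (isCompact_sphere (0 : n → ℝ) 1).exists_isMinOn
    (NormedSpace.sphere_nonempty.mpr zero_le_one) hcont.continuousOn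
  have hx₀0 : x₀ ≠ 0 := by
    rintro rfl
    simp at hx₀
  have hc₀ : 0 < x₀ ⬝ᵥ V.mulVec x₀ := by simpa using hV.dotProduct_mulVec_pos hx₀0
  set c₀ := x₀ ⬝ᵥ V.mulVec x₀
  have hcard : (0 : ℝ) < Fintype.card n := by exact_mod_cast Fintype.card_pos
  -- The sphere is that of the sup norm, so passing to the sum of squares costs a factor `card n`.
  refine ⟨c₀ / Fintype.card n, by positivity, fun x => ?_⟩
  have h1 : ∑ i, x i ^ 2 ≤ Fintype.card n * ‖x‖ ^ 2 := by
    calc ∑ i, x i ^ 2 ≤ ∑ _i : n, ‖x‖ ^ 2 := Finset.sum_le_sum fun i _ => by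
          rw [← sq_abs]
          exact pow_le_pow_left₀ (abs_nonneg _) (norm_le_pi_norm x i) 2
      _ = Fintype.card n * ‖x‖ ^ 2 := by simp
  have h2 : c₀ * ‖x‖ ^ 2 ≤ x ⬝ᵥ V.mulVec x := by
    rcases eq_or_ne x 0 with rfl | hx
    · simp
    have hx' : 0 < ‖x‖ := norm_pos_iff.mpr hx
    have := hmin (a := ‖x‖⁻¹ • x) (by simp [norm_smul, hx'.ne'])
    simp only [Set.mem_ofPred_eq, Matrix.mulVec_smul, dotProduct_smul, smul_dotProduct,
      smul_eq_mul] at this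
    calc c₀ * ‖x‖ ^ 2 ≤ (‖x‖⁻¹ * (‖x‖⁻¹ * (x ⬝ᵥ V.mulVec x))) * ‖x‖ ^ 2 := by gcongr
      _ = x ⬝ᵥ V.mulVec x := by field_simp
  calc c₀ / Fintype.card n * ∑ i, x i ^ 2
      ≤ c₀ / Fintype.card n * (Fintype.card n * ‖x‖ ^ 2) := by gcongr
    _ = c₀ * ‖x‖ ^ 2 := by field_simp
    _ ≤ _ := h2

variable [DecidableEq n]

theorem measurable_normalDensity (V : Matrix n n ℝ) : Measurable (normalDensity V) := by
  have : Continuous fun x : n → ℝ => x ⬝ᵥ V⁻¹.mulVec x := by fun_prop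
  unfold normalDensity
  exact ENNReal.measurable_ofReal.comp (by fun_prop : Continuous _).measurable

theorem normalDensity_ne_zero {V : Matrix n n ℝ} (hV : V.PosDef) (x : n → ℝ) :
    normalDensity V x ≠ 0 := by
  have := hV.det_pos
  unfold normalDensity
  rw [Ne, ENNReal.ofReal_eq_zero, not_le]
  positivity

theorem normalDensity_ne_top (V : Matrix n n ℝ) (x : n → ℝ) : normalDensity V x ≠ ∞ :=
  ENNReal.ofReal_ne_top

/-- A dominating function in product form reduces finiteness of integrals over products of fibres to
one coordinate. -/
theorem exists_normalDensity_le {V : Matrix n n ℝ} (hV : V.PosDef) :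
    ∃ (C : ℝ≥0∞) (c : ℝ), C ≠ ∞ ∧ 0 < c ∧
      ∀ x, normalDensity V x ≤ C * ∏ i, ENNReal.ofReal (Real.exp (-c * x i ^ 2)) := by
  obtain ⟨c, hc, h⟩ := exists_mul_sum_sq_le_of_posDef hV.inv
  refine ⟨ENNReal.ofReal (Real.sqrt ((2 * Real.pi) ^ Fintype.card n * V.det))⁻¹, c / 2,
    ENNReal.ofReal_ne_top, by positivity, fun x => ?_⟩
  unfold normalDensity
  rw [ENNReal.ofReal_mul (by positivity)]
  gcongr
  rw [← ENNReal.ofReal_prod_of_nonneg fun i _ => (Real.exp_pos _).le, ← Real.exp_sum,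
    ← Finset.mul_sum]
  gcongr
  linarith [h x]

theorem normalDensity_comp_equiv {V : Matrix n n ℝ} (e : n ≃ n) (hV : V.submatrix e e = V)
    (x : n → ℝ) : normalDensity V (x ∘ e) = normalDensity V x := by
  have h1 : V⁻¹.submatrix e e = V⁻¹ := by rw [← Matrix.inv_submatrix_equiv, hV]
  have h2 : (x ∘ e) ⬝ᵥ V⁻¹.mulVec (x ∘ e) = x ⬝ᵥ V⁻¹.mulVec x := by
    conv_lhs => rw [← h1]
    simp only [dotProduct, Matrix.mulVec, Matrix.submatrix_apply, Function.comp]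
    rw [← e.sum_comp (fun i => x i * ∑ k, V⁻¹ i k * x k)]
    refine Finset.sum_congr rfl fun i _ => ?_
    rw [← e.sum_comp (fun k => V⁻¹ (e i) k * x k)]
  unfold normalDensity
  rw [h2]

end Normal

/-- The four blocks differ only on their diagonals, since `S` is diagonal. The transposition thus
affects only the entries linking `j` to its own copy, where both variances agree and both
covariances agree. -/
theorem jointCov_submatrix_swap {p : ℕ} {V : Matrix (Fin p) (Fin p) ℝ} (s : Fin p → ℝ)
    (j : Fin p) :
    (jointCov V s).submatrix (Equiv.swap (Sum.inl j) (Sum.inr j))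
      (Equiv.swap (Sum.inl j) (Sum.inr j)) = jointCov V s := by
  ext a b
  have hl (k : Fin p) (h : k ≠ j) :
      Equiv.swap (Sum.inl j : Fin p ⊕ Fin p) (Sum.inr j) (Sum.inl k) = Sum.inl k :=
    Equiv.swap_apply_of_ne_of_ne (by simpa using h) (by simp)
  have hr (k : Fin p) (h : k ≠ j) :
      Equiv.swap (Sum.inl j : Fin p ⊕ Fin p) (Sum.inr j) (Sum.inr k) = Sum.inr k :=
    Equiv.swap_apply_of_ne_of_ne (by simp) (by simpa using h)
  simp only [Matrix.submatrix_apply, jointCov]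
  rcases a with a | a <;> rcases b with b | b <;> by_cases ha : a = j <;> by_cases hb : b = j <;>
    first
      | subst ha; subst hb; simp
      | (subst ha; simp [hl b hb, hr b hb, Matrix.diagonal, Ne.symm hb])
      | (subst hb; simp [hl a ha, hr a ha, Matrix.diagonal, ha])
      | simp [hl _ ha, hl _ hb, hr _ ha, hr _ hb]

theorem normalDensity_jointCov_swapPair {p : ℕ} (V : Matrix (Fin p) (Fin p) ℝ) (s : Fin p → ℝ)
    (j : Fin p) (x : (Fin p → ℝ) × (Fin p → ℝ)) :
    normalDensity (jointCov V s) (Sum.elim (swapPair j x).1 (swapPair j x).2) =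
      normalDensity (jointCov V s) (Sum.elim x.1 x.2) := by
  rw [sumElim_swapPair, normalDensity_comp_equiv _ (jointCov_submatrix_swap s j)]

/-! ### Families of product measures -/

/-- The measures `κ z` are images of measures with densities with respect to a common measure, the
densities and maps depending measurably on `z`. -/
def IsParametrized (κ : ℝ → Measure ℝ) : Prop :=
  ∃ (b : Measure ℝ) (w : ℝ × ℝ → ℝ≥0∞) (φ : ℝ × ℝ → ℝ), SigmaFinite b ∧ Measurable w ∧
    Measurable φ ∧ (∀ a, w a ≠ ∞) ∧
    ∀ z, κ z = (b.withDensity fun u => w (z, u)).map fun u => φ (z, u)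

theorem isParametrized_const (b : Measure ℝ) [SigmaFinite b] : IsParametrized fun _ => b :=
  ⟨b, fun _ => 1, Prod.snd, inferInstance, measurable_const, measurable_snd,
    fun _ => ENNReal.one_ne_top, fun _ => by
      have : (fun _ : ℝ => (1 : ℝ≥0∞)) = 1 := rfl
      simp [this]⟩

section Pi

variable {n : Type*} [Fintype n] {κ : n → ℝ → Measure ℝ} [∀ j z, SigmaFinite (κ j z)]

/-- All dependence on `z` is moved from the measure into the integrand, over a fixed base measure.
Measurability in `z` of fibre integrals then follows from Tonelli. -/
theorem exists_lintegral_pi_eq (h : ∀ j, IsParametrized (κ j)) :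
    ∃ (b : Measure (n → ℝ)) (w : (n → ℝ) × (n → ℝ) → ℝ≥0∞) (φ : (n → ℝ) × (n → ℝ) → n → ℝ),
      SFinite b ∧ Measurable w ∧ Measurable φ ∧ ∀ z (F : (n → ℝ) → ℝ≥0∞), Measurable F →
        ∫⁻ x, F x ∂(Measure.pi fun j => κ j (z j)) = ∫⁻ u, w (z, u) * F (φ (z, u)) ∂b := by
  choose b w φ hb hw hφ hwt hκ using h
  have hw' (j : n) (z : ℝ) : Measurable fun u => w j (z, u) := (hw j).comp measurable_prodMk_left
  have hφ' (j : n) (z : ℝ) : Measurable fun u => φ j (z, u) := (hφ j).comp measurable_prodMk_left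
  have hpi : ∀ j : n, Measurable fun a : (n → ℝ) × (n → ℝ) => (a.1 j, a.2 j) := fun j =>
    ((measurable_pi_apply j).comp measurable_fst).prodMk
      ((measurable_pi_apply j).comp measurable_snd)
  have hwm : Measurable fun a : (n → ℝ) × (n → ℝ) => ∏ j, w j (a.1 j, a.2 j) :=
    Finset.measurable_prod _ fun j _ => (hw j).comp (hpi j)
  have hφm : Measurable fun a : (n → ℝ) × (n → ℝ) => fun j => φ j (a.1 j, a.2 j) :=
    measurable_pi_lambda _ fun j => (hφ j).comp (hpi j)
  refine ⟨Measure.pi b, fun a => ∏ j, w j (a.1 j, a.2 j), fun a j => φ j (a.1 j, a.2 j),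
    inferInstance, hwm, hφm, fun z F hF => ?_⟩
  have hsf : ∀ j, SigmaFinite ((b j).withDensity fun u => w j (z j, u)) := fun j =>
    SigmaFinite.withDensity_of_ne_top (Filter.Eventually.of_forall fun u => hwt j _)
  have hsf' : ∀ j, SigmaFinite
      (((b j).withDensity fun u => w j (z j, u)).map fun u => φ j (z j, u)) := fun j => by
    rw [← hκ]; infer_instance
  have h1 : (Measure.pi fun j => κ j (z j)) =
      ((Measure.pi b).withDensity fun u => ∏ j, w j (z j, u j)).map
        fun u j => φ j (z j, u j) := by
    simp_rw [hκ]
    rw [← Measure.pi_map_pi fun j => (hφ' j (z j)).aemeasurable,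
      pi_withDensity b fun j => hw' j (z j)]
  have hφz : Measurable fun (u : n → ℝ) j => φ j (z j, u j) := hφm.comp measurable_prodMk_left
  have hwz : Measurable fun u : n → ℝ => ∏ j, w j (z j, u j) := hwm.comp measurable_prodMk_left
  rw [h1, lintegral_map hF hφz]
  exact lintegral_withDensity_mul _ hwz (hF.comp hφz)

theorem measurable_lintegral_pi (h : ∀ j, IsParametrized (κ j)) {T : Type*} [MeasurableSpace T]
    {G : T × (n → ℝ) → ℝ≥0∞} (hG : Measurable G) {ζ : T → n → ℝ} (hζ : Measurable ζ) :
    Measurable fun t => ∫⁻ x, G (t, x) ∂(Measure.pi fun j => κ j (ζ t j)) := by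
  obtain ⟨b, w, φ, hb, hw, hφ, heq⟩ := exists_lintegral_pi_eq h
  have h1 : (fun t => ∫⁻ x, G (t, x) ∂(Measure.pi fun j => κ j (ζ t j))) =
      fun t => ∫⁻ u, w (ζ t, u) * G (t, φ (ζ t, u)) ∂b := by
    funext t
    exact heq (ζ t) (fun x => G (t, x)) (hG.comp measurable_prodMk_left)
  have h2 : Measurable fun a : T × (n → ℝ) => (ζ a.1, a.2) :=
    (hζ.comp measurable_fst).prodMk measurable_snd
  rw [h1]
  exact Measurable.lintegral_prod_right'
    (f := fun a : T × (n → ℝ) => w (ζ a.1, a.2) * G (a.1, φ (ζ a.1, a.2)))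
    ((hw.comp h2).mul (hG.comp (measurable_fst.prodMk (hφ.comp h2))))

theorem measurable_pi_measure (h : ∀ j, IsParametrized (κ j)) :
    Measurable fun z : n → ℝ => Measure.pi fun j => κ j (z j) := by
  refine Measure.measurable_of_measurable_coe _ fun s hs => ?_
  have := measurable_lintegral_pi h (T := n → ℝ) (G := fun a => s.indicator 1 a.2)
    ((measurable_one.indicator hs).comp measurable_snd) measurable_id
  simpa [lintegral_indicator_one hs] using this

/-- Disintegration passes from the coordinates to the product: on a box, the mixture of product
measures factorises. -/
theorem lintegral_lintegral_pi (h : ∀ j, IsParametrized (κ j)) (l ρ : n → Measure ℝ)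
    [∀ j, SigmaFinite (l j)] [∀ j, SigmaFinite (ρ j)]
    (hκ : ∀ j s, MeasurableSet s → ∫⁻ z, κ j z s ∂(l j) = ρ j s)
    {F : (n → ℝ) → ℝ≥0∞} (hF : Measurable F) :
    ∫⁻ z, ∫⁻ x, F x ∂(Measure.pi fun j => κ j (z j)) ∂(Measure.pi l) =
      ∫⁻ x, F x ∂(Measure.pi ρ) := by
  have hm := measurable_pi_measure h
  rw [← Measure.lintegral_bind hm.aemeasurable hF.aemeasurable]
  congr 1
  refine (Measure.pi_eq fun s hs => ?_).symm
  rw [Measure.bind_apply (MeasurableSet.univ_pi hs) hm.aemeasurable]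
  simp_rw [Measure.pi_pi]
  have hmj (j : n) : Measurable fun z => κ j z (s j) := by
    obtain ⟨b, w, φ, hb, hw, hφ, hwt, heq⟩ := h j
    have h1 : (fun z => κ j z (s j)) = fun z => ∫⁻ u, w (z, u) * (s j).indicator 1 (φ (z, u)) ∂b := by
      funext z
      have hφz : Measurable fun u => φ (z, u) := hφ.comp measurable_prodMk_left
      rw [← lintegral_indicator_one (hs j), heq,
        lintegral_map (measurable_one.indicator (hs j)) hφz]
      have hwz : Measurable fun u => w (z, u) := hw.comp measurable_prodMk_left
      exact lintegral_withDensity_mul _ hwz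
        ((measurable_one.indicator (hs j)).comp hφz)
    rw [h1]
    exact Measurable.lintegral_prod_right'
      (f := fun a : ℝ × ℝ => w a * (s j).indicator 1 (φ a))
      (hw.mul ((measurable_one.indicator (hs j)).comp hφ))
  rw [lintegral_pi_prod l hmj]
  exact Finset.prod_congr rfl fun j _ => hκ j _ (hs j)

end Pi

/-! ### The fibres of the transformations -/

/-- The possible values of a predictor. -/
def PredictorKind.values : PredictorKind → Set ℝ
  | .continuous => Set.univ
  | .categorical K => Set.range fun k : Fin (K + 1) => ((k : ℕ) : ℝ)

/-- Lebesgue measure for a continuous predictor, and counting measure on the values for a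
categorical one. -/
def PredictorKind.refMeasure : PredictorKind → Measure ℝ
  | .continuous => volume
  | .categorical K => Measure.sum fun k : Fin (K + 1) => Measure.dirac ((k : ℕ) : ℝ)

instance (κ : PredictorKind) : SigmaFinite κ.refMeasure := by
  cases κ <;> unfold PredictorKind.refMeasure <;> infer_instance

namespace Transform

variable {κ : PredictorKind} (T : Transform κ)

theorem measurable_toFun : Measurable T.toFun := by
  cases T with
  | affine c d hd => exact (measurable_id.const_mul d).const_add c
  | cuts c hc =>
    unfold toFun
    simp_rw [Finset.card_filter]
    push_cast
    exact Finset.measurable_sum _ fun k _ =>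
      Measurable.ite measurableSet_Ioi measurable_const measurable_const

theorem toFun_mem_values (x : ℝ) : T.toFun x ∈ κ.values := by
  cases T with
  | affine c d hd => trivial
  | @cuts K c hc =>
    exact ⟨⟨_, Nat.lt_succ_of_le ((Finset.card_filter_le _ _).trans (Finset.card_fin K).le)⟩, rfl⟩

instance (z : ℝ) : SigmaFinite (T.fibre z) := by
  cases T with
  | affine c d hd =>
    have : IsFiniteMeasure (ENNReal.ofReal d⁻¹ • Measure.dirac ((z - c) / d)) :=
      Measure.smul_finite _ ENNReal.ofReal_ne_top
    exact (inferInstance :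
      SigmaFinite (ENNReal.ofReal d⁻¹ • Measure.dirac ((z - c) / d)))
  | cuts c hc => unfold fibre; infer_instance

/-- A moving point mass is the image of a fixed one under a moving map; a restriction to a moving
level set is a moving indicator density. -/
theorem isParametrized_fibre : IsParametrized T.fibre := by
  cases T with
  | affine c d hd =>
    refine ⟨Measure.dirac 0, fun _ => ENNReal.ofReal d⁻¹, fun a => (a.1 - c) / d, inferInstance,
      measurable_const, (measurable_fst.sub_const c).div_const d,
      fun _ => ENNReal.ofReal_ne_top, fun z => ?_⟩
    have hm : Measurable fun _ : ℝ => (z - c) / d := measurable_const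
    rw [withDensity_const, Measure.map_smul, Measure.map_dirac' hm]
    rfl
  | cuts c hc =>
    have hT : Measurable fun a : ℝ × ℝ => (cuts c hc).toFun a.2 :=
      (cuts c hc).measurable_toFun.comp measurable_snd
    have hs : MeasurableSet {a : ℝ × ℝ | (cuts c hc).toFun a.2 = a.1} :=
      measurableSet_eq_fun hT measurable_fst
    refine ⟨volume, {a : ℝ × ℝ | (cuts c hc).toFun a.2 = a.1}.indicator 1, Prod.snd, inferInstance,
      measurable_one.indicator hs, measurable_snd, fun a => ?_, fun z => ?_⟩
    · by_cases h : a ∈ {a : ℝ × ℝ | (cuts c hc).toFun a.2 = a.1} <;> simp [h]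
    · have : MeasurableSet {x | (cuts c hc).toFun x = z} := measurable_prodMk_left (x := z) hs
      rw [Measure.map_id', fibre, ← withDensity_indicator_one this]
      rfl

theorem ae_fibre (z : ℝ) : ∀ᵐ x ∂(T.fibre z), T.toFun x = z := by
  cases T with
  | affine c d hd =>
    refine Measure.ae_smul_measure ?_ _
    rw [ae_dirac_eq]
    change c + d * ((z - c) / d) = z
    field_simp
    ring
  | cuts c hc =>
    exact ae_restrict_mem ((cuts c hc).measurable_toFun (measurableSet_singleton z))

/-- In the affine case the factor `d⁻¹` cancels the Jacobian; in the categorical case the level sets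
partition the line. -/
theorem lintegral_fibre_apply {s : Set ℝ} (hs : MeasurableSet s) :
    ∫⁻ z, T.fibre z s ∂κ.refMeasure = volume s := by
  cases T with
  | affine c d hd =>
    simp only [PredictorKind.refMeasure, fibre, Measure.smul_apply, smul_eq_mul,
      Measure.dirac_apply' _ hs]
    rw [lintegral_const_mul' _ _ ENNReal.ofReal_ne_top,
      lintegral_sub_right_eq_self (fun z => s.indicator (1 : ℝ → ℝ≥0∞) (z / d)) c]
    simp_rw [div_eq_inv_mul]
    have hm : Measurable fun z : ℝ => d⁻¹ * z := measurable_const_mul _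
    rw [← lintegral_map (measurable_one.indicator hs) hm,
      Real.map_volume_mul_left (inv_ne_zero hd.ne'), lintegral_smul_measure,
      lintegral_indicator_one hs, inv_inv, abs_of_pos hd, smul_eq_mul, ← mul_assoc,
      ← ENNReal.ofReal_mul (by positivity), inv_mul_cancel₀ hd.ne', ENNReal.ofReal_one, one_mul]
  | @cuts K c hc =>
    have hm : Measurable (cuts c hc).toFun := (cuts c hc).measurable_toFun
    simp only [PredictorKind.refMeasure, fibre, lintegral_sum_measure, tsum_fintype,
      lintegral_dirac, Measure.restrict_apply hs]
    rw [← measure_biUnion_finset]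
    · congr 1
      ext x
      simp only [Set.mem_iUnion, Finset.mem_univ, Set.mem_inter_iff, exists_true_left,
        exists_and_left, and_iff_left_iff_imp]
      obtain ⟨k, hk⟩ := (cuts c hc).toFun_mem_values x
      exact fun _ => ⟨k, hk.symm⟩
    · intro k _ k' _ hkk
      refine Set.disjoint_left.mpr fun x hx hx' => hkk (Fin.ext ?_)
      exact_mod_cast hx.2.symm.trans hx'.2
    · exact fun k _ => hs.inter (hm (measurableSet_singleton _))

/-- Strictly increasing cut points leave room for an open interval in every level set. This makes
the densities positive at attainable values. -/
theorem fibre_ne_zero {z : ℝ} (hz : z ∈ κ.values) : T.fibre z ≠ 0 := by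
  cases T with
  | affine c d hd =>
    intro h
    have := congrArg (fun m => m Set.univ) h
    simp [fibre, hd] at this
  | @cuts K c hc =>
    obtain ⟨k, rfl⟩ := hz
    have hsub : ∃ a b : ℝ, a < b ∧
        Set.Ioo a b ⊆ {x | (cuts c hc).toFun x = ((k : ℕ) : ℝ)} := by
      have key (x : ℝ) (h1 : ∀ i : Fin K, (i : ℕ) < k → c i < x)
          (h2 : ∀ i : Fin K, (k : ℕ) ≤ i → x ≤ c i) :
          (cuts c hc).toFun x = ((k : ℕ) : ℝ) := by
        change ((Finset.univ.filter fun i => c i < x).card : ℝ) = _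
        have : (Finset.univ.filter fun i => c i < x) =
            Finset.univ.filter fun i : Fin K => (i : ℕ) < k := by
          ext i
          simp only [Finset.mem_filter, Finset.mem_univ, true_and]
          exact ⟨fun h => not_le.mp fun h' => absurd (h2 i h') (not_le.mpr h), h1 i⟩
        rw [this, Fin.card_filter_val_lt]
        simp [Nat.lt_succ_iff.mp k.2]
      -- `b` is the next cut point, or any point beyond all of them for the top category. Points
      -- slightly to its left take the value `k`.
      obtain ⟨b, hb1, hb2⟩ : ∃ b : ℝ, (∀ i : Fin K, (i : ℕ) < k → c i < b) ∧
          ∀ i : Fin K, (k : ℕ) ≤ i → b ≤ c i := by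
        by_cases h : (k : ℕ) < K
        · exact ⟨c ⟨k, h⟩, fun i hi => hc (Fin.lt_def.mpr hi),
            fun i hi => hc.monotone (Fin.le_def.mpr hi)⟩
        · obtain ⟨m, hm⟩ := (Set.finite_range c).bddAbove
          exact ⟨m + 1, fun i _ => (hm ⟨i, rfl⟩).trans_lt (lt_add_one m),
            fun i hi => absurd (hi.trans_lt i.2) h⟩
      have hev : ∀ᶠ x in nhdsWithin b (Set.Iio b), ∀ i : Fin K, (i : ℕ) < k → c i < x := by
        rw [Filter.eventually_all]
        intro i
        by_cases hi : (i : ℕ) < k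
        · exact (eventually_nhdsWithin_of_eventually_nhds (lt_mem_nhds (hb1 i hi))).mono
            fun x hx _ => hx
        · exact Filter.Eventually.of_forall fun x h => absurd h hi
      obtain ⟨a, hab, ha⟩ := (mem_nhdsLT_iff_exists_Ioo_subset).mp hev
      exact ⟨a, b, hab, fun x hx => key x (ha hx) fun i hi => hx.2.le.trans (hb2 i hi)⟩
    obtain ⟨a, b, hab, hsub⟩ := hsub
    intro h
    have h0 : volume {x | (cuts c hc).toFun x = ((k : ℕ) : ℝ)} = 0 := by
      have := congrArg (fun m => m Set.univ) h
      simpa [fibre] using this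
    have := measure_mono_null hsub h0
    rw [Real.volume_Ioo, ENNReal.ofReal_eq_zero] at this
    linarith

theorem lintegral_exp_fibre_ne_top {c : ℝ} (hc : 0 < c) (z : ℝ) :
    ∫⁻ x, ENNReal.ofReal (Real.exp (-c * x ^ 2)) ∂(T.fibre z) ≠ ∞ := by
  cases T with
  | affine c' d hd =>
    simp only [fibre, lintegral_smul_measure, lintegral_dirac, smul_eq_mul]
    exact ENNReal.mul_ne_top ENNReal.ofReal_ne_top ENNReal.ofReal_ne_top
  | cuts c' hc' =>
    exact ((setLIntegral_le_lintegral _ _).trans_lt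
      (integrable_exp_neg_mul_sq hc).lintegral_lt_top).ne

end Transform

/-! ### The measurement model -/

section Items

variable {ι : Type*} (I : Items ι)

theorem Items.prob_pos (l : ι) (t : ℝ) (k : ℕ) : 0 < I.prob l t k :=
  div_pos (Real.exp_pos _) (Finset.sum_pos (fun _ _ => Real.exp_pos _) (by simp))

theorem Items.prob_le_one (l : ι) (t : ℝ) (k : Fin (I.K l + 1)) : I.prob l t k ≤ 1 := by
  unfold Items.prob
  refine div_le_one_of_le₀ ?_ (Finset.sum_nonneg fun _ _ => (Real.exp_pos _).le)
  exact Finset.single_le_sum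
    (f := fun m => Real.exp (∑ r ∈ Finset.Icc 1 m, (I.a l * t + I.b l r)))
    (fun _ _ => (Real.exp_pos _).le) (Finset.mem_range.mpr k.2)

theorem Items.measurable_prob (l : ι) (k : ℕ) : Measurable fun t => I.prob l t k := by
  unfold Items.prob
  refine Measurable.div ?_ ?_
  · exact (by fun_prop : Continuous _).measurable
  · exact (by fun_prop : Continuous _).measurable

variable {I} {B : Finset ι}

theorem Items.measurable_respProb (y : I.Resp B) : Measurable fun t => I.respProb t y :=
  Finset.measurable_prod _ fun l _ => ENNReal.measurable_ofReal.comp (I.measurable_prob l (y l))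

theorem Items.respProb_ne_zero (y : I.Resp B) (t : ℝ) : I.respProb t y ≠ 0 :=
  Finset.prod_ne_zero_iff.mpr fun l _ => by simpa using I.prob_pos l t (y l)

theorem Items.respProb_le_one (y : I.Resp B) (t : ℝ) : I.respProb t y ≤ 1 :=
  Finset.prod_le_one' fun l _ => by simpa using I.prob_le_one l t (y l)

end Items

/-! ### Masked predictors, fibres over observed values, and densities -/

theorem mask_mask {p : ℕ} (α : Finset (Fin p)) (z : Fin p → ℝ) :
    mask α (mask α z) = mask α z := by
  funext j
  by_cases h : j ∈ α <;> simp [mask, h]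

theorem measurable_mask {p : ℕ} (α : Finset (Fin p)) : Measurable (mask α) :=
  measurable_pi_lambda _ fun j => by
    by_cases h : j ∈ α <;> simp only [mask, h, if_true, if_false]
    · exact measurable_pi_apply j
    · exact measurable_const

/-- The measure with respect to which `(Z_j)_{j ∈ α}` has a density; the missing entries are
set to `0`. -/
def refMeasure {p : ℕ} (kind : Fin p → PredictorKind) (α : Finset (Fin p)) :
    Measure (Fin p → ℝ) :=
  Measure.pi fun j => if j ∈ α then (kind j).refMeasure else Measure.dirac 0

section Model

variable {p : ℕ} {kind : Fin p → PredictorKind} {ι : Type*}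

instance (α : Finset (Fin p)) (j : Fin p) :
    SigmaFinite (if j ∈ α then (kind j).refMeasure else Measure.dirac 0) := by
  split_ifs <;> infer_instance

instance (α : Finset (Fin p)) : SigmaFinite (refMeasure kind α) := by
  unfold refMeasure; infer_instance

namespace Params

variable (M : Params kind) (I : Items ι) {B : Finset ι}

theorem measurable_predictors : Measurable M.predictors :=
  measurable_pi_lambda _ fun j => (M.transf j).measurable_toFun.comp (measurable_pi_apply j)

theorem predictors_mem_values (x : Fin p → ℝ) (j : Fin p) : M.predictors x j ∈ (kind j).values :=
  (M.transf j).toFun_mem_values _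

/-- The factors of `Params.fibre`. -/
def coordFibre (α : Finset (Fin p)) (j : Fin p) (z : ℝ) : Measure ℝ :=
  if j ∈ α then (M.transf j).fibre z else volume

theorem fibre_eq (α : Finset (Fin p)) (z : Fin p → ℝ) :
    M.fibre α z = Measure.pi fun j => M.coordFibre α j (z j) := rfl

instance (α : Finset (Fin p)) (j : Fin p) (z : ℝ) : SigmaFinite (M.coordFibre α j z) := by
  unfold coordFibre; split_ifs <;> infer_instance

instance (α : Finset (Fin p)) (z : Fin p → ℝ) : SigmaFinite (M.fibre α z) := by
  rw [fibre_eq]; infer_instance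

theorem isParametrized_coordFibre (α : Finset (Fin p)) (j : Fin p) :
    IsParametrized (M.coordFibre α j) := by
  unfold coordFibre
  split_ifs
  · exact (M.transf j).isParametrized_fibre
  · exact isParametrized_const volume

theorem fibre_congr {α : Finset (Fin p)} {z z' : Fin p → ℝ} (h : ∀ j ∈ α, z j = z' j) :
    M.fibre α z = M.fibre α z' := by
  unfold fibre
  congr 1
  funext j
  by_cases hj : j ∈ α
  · simp [hj, h j hj]
  · simp [hj]

theorem measurable_lintegral_fibre (α : Finset (Fin p)) {T : Type*} [MeasurableSpace T]
    {G : T × (Fin p → ℝ) → ℝ≥0∞} (hG : Measurable G) {ζ : T → Fin p → ℝ} (hζ : Measurable ζ) :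
    Measurable fun t => ∫⁻ x, G (t, x) ∂(M.fibre α (ζ t)) :=
  measurable_lintegral_pi (M.isParametrized_coordFibre α) hG hζ

theorem lintegral_lintegral_fibre (α : Finset (Fin p)) {F : (Fin p → ℝ) → ℝ≥0∞}
    (hF : Measurable F) :
    ∫⁻ z, ∫⁻ x, F x ∂(M.fibre α z) ∂(refMeasure kind α) = ∫⁻ x, F x := by
  refine lintegral_lintegral_pi (M.isParametrized_coordFibre α) _ (fun _ => volume) ?_ hF
  intro j s hs
  unfold coordFibre
  split_ifs
  · exact (M.transf j).lintegral_fibre_apply hs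
  · simp

/-- On the fibre over `z` the observed predictors are the constant `z`, so functions of them can be
taken out of fibre integrals. At missing entries both sides are `0`, by the point masses in
`refMeasure`. -/
theorem ae_fibre (α : Finset (Fin p)) :
    ∀ᵐ z ∂(refMeasure kind α), ∀ᵐ x ∂(M.fibre α z), mask α (M.predictors x) = z := by
  have h0 : ∀ᵐ z ∂(refMeasure kind α), ∀ j, j ∉ α → z j = 0 := by
    rw [ae_all_iff]
    intro j
    by_cases hj : j ∈ α
    · exact Filter.Eventually.of_forall fun z h => absurd hj h
    · refine (Measure.tendsto_eval_ae_ae.eventually (p := fun t : ℝ => t = 0) ?_).mono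
        fun z hz _ => hz
      simp [hj, ae_dirac_eq]
  filter_upwards [h0] with z hz
  have h1 : ∀ᵐ x ∂(M.fibre α z), ∀ j, j ∈ α → (M.transf j).toFun (x j) = z j := by
    rw [ae_all_iff, fibre_eq]
    intro j
    by_cases hj : j ∈ α
    · refine ((Measure.tendsto_eval_ae_ae (i := j)).eventually
        (p := fun t : ℝ => (M.transf j).toFun t = z j) ?_).mono fun x hx _ => hx
      simpa [coordFibre, hj] using (M.transf j).ae_fibre (z j)
    · exact Filter.Eventually.of_forall fun z h => absurd h hj
  filter_upwards [h1] with x hx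
  funext j
  by_cases hj : j ∈ α
  · simp only [mask, hj, if_true]
    exact hx j hj
  · simp [mask, hj, hz j hj]

/-! ### Densities -/

theorem measurable_regressor (κ : PredictorKind) (k : Fin κ.dim) :
    Measurable fun z => κ.regressor z k := by
  cases κ with
  | continuous => exact measurable_id
  | categorical K =>
    exact Measurable.ite measurableSet_Ici measurable_const measurable_const

theorem measurable_abilityMean : Measurable M.abilityMean := by
  unfold abilityMean
  refine (Finset.measurable_sum _ fun j _ => Finset.measurable_sum _ fun k _ => ?_).const_add _
  exact ((measurable_regressor (kind j) k).comp (measurable_pi_apply j)).const_mul _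

variable {I}

/-- Centring the Gaussian makes the measure independent of `z`. -/
theorem measurable_respDensity (y : I.Resp B) : Measurable (M.respDensity I y) := by
  have h1 : M.respDensity I y = fun z =>
      ∫⁻ t, I.respProb (M.abilityMean z + t) y ∂(gaussianReal 0 M.resVar) := by
    funext z
    unfold respDensity
    have hm : Measurable fun t : ℝ => M.abilityMean z + t := measurable_const_add _
    rw [← lintegral_map (f := fun t => I.respProb t y) (Items.measurable_respProb y) hm,
      gaussianReal_map_const_add, zero_add]
  rw [h1]
  exact Measurable.lintegral_prod_right'
    (f := fun a : (Fin p → ℝ) × ℝ => I.respProb (M.abilityMean a.1 + a.2) y)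
    ((Items.measurable_respProb y).comp
      ((M.measurable_abilityMean.comp measurable_fst).add measurable_snd))

theorem respDensity_ne_zero (y : I.Resp B) (z : Fin p → ℝ) : M.respDensity I y z ≠ 0 := by
  unfold respDensity
  rw [Ne, lintegral_eq_zero_iff (Items.measurable_respProb y)]
  intro h
  obtain ⟨t, ht⟩ := h.exists
  exact Items.respProb_ne_zero y t ht

theorem respDensity_le_one (y : I.Resp B) (z : Fin p → ℝ) : M.respDensity I y z ≤ 1 := by
  unfold respDensity
  calc ∫⁻ t, I.respProb t y ∂(gaussianReal (M.abilityMean z) M.resVar)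
      ≤ ∫⁻ _, 1 ∂(gaussianReal (M.abilityMean z) M.resVar) :=
        lintegral_mono fun t => Items.respProb_le_one y t
    _ = 1 := by simp

theorem respDensity_update {j : Fin p} (hj : j ∉ M.nonNull) (y : I.Resp B) {z z' : Fin p → ℝ}
    (h : ∀ k, k ≠ j → z k = z' k) : M.respDensity I y z = M.respDensity I y z' := by
  have hj' : M.slope j = 0 := not_not.mp hj
  have : M.abilityMean z = M.abilityMean z' := by
    unfold abilityMean
    congr 1
    refine Finset.sum_congr rfl fun k _ => ?_
    by_cases hk : k = j
    · subst hk; simp [hj']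
    · rw [h k hk]
  unfold respDensity
  rw [this]

theorem fibre_ne_zero {α : Finset (Fin p)} {z : Fin p → ℝ}
    (hz : ∀ j ∈ α, z j ∈ (kind j).values) : M.fibre α z ≠ 0 := by
  rw [← Measure.measure_univ_ne_zero, fibre_eq, ← Set.pi_univ, Measure.pi_pi]
  refine Finset.prod_ne_zero_iff.mpr fun j _ => ?_
  rw [Measure.measure_univ_ne_zero]
  unfold coordFibre
  split_ifs with hj
  · exact (M.transf j).fibre_ne_zero (hz j hj)
  · exact NeZero.ne _

theorem lintegral_exp_fibre_ne_top (α : Finset (Fin p)) (z : Fin p → ℝ) {c : ℝ} (hc : 0 < c) :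
    ∫⁻ x, ∏ j, ENNReal.ofReal (Real.exp (-c * x j ^ 2)) ∂(M.fibre α z) ≠ ∞ := by
  rw [fibre_eq, lintegral_pi_prod _ (f := fun _ t => ENNReal.ofReal (Real.exp (-c * t ^ 2)))
    fun j => by fun_prop]
  refine ENNReal.prod_ne_top fun j _ => ?_
  unfold coordFibre
  split_ifs
  · exact (M.transf j).lintegral_exp_fibre_ne_top hc _
  · exact (integrable_exp_neg_mul_sq hc).lintegral_lt_top.ne

theorem measurable_obsIntegrand (y : I.Resp B) :
    Measurable fun x => normalDensity M.corr x * M.respDensity I y (M.predictors x) :=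
  (measurable_normalDensity _).mul ((M.measurable_respDensity y).comp M.measurable_predictors)

theorem measurable_jointIntegrand (s : Fin p → ℝ) (y : I.Resp B) :
    Measurable fun a : (Fin p → ℝ) × (Fin p → ℝ) =>
      normalDensity (jointCov M.corr s) (Sum.elim a.1 a.2) *
        M.respDensity I y (M.predictors a.1) := by
  have : Measurable fun a : (Fin p → ℝ) × (Fin p → ℝ) => Sum.elim a.1 a.2 := by
    refine measurable_pi_lambda _ fun k => ?_
    rcases k with k | k
    · exact (measurable_pi_apply k).comp measurable_fst
    · exact (measurable_pi_apply k).comp measurable_snd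
  exact ((measurable_normalDensity _).comp this).mul
    ((M.measurable_respDensity y).comp (M.measurable_predictors.comp measurable_fst))

theorem measurable_obsDensity (α : Finset (Fin p)) (y : I.Resp B) :
    Measurable fun z => M.obsDensity I α z y :=
  M.measurable_lintegral_fibre α ((M.measurable_obsIntegrand y).comp measurable_snd) measurable_id

theorem jointDensity_eq_lintegral_prod (s : Fin p → ℝ) (α : Finset (Fin p))
    (z zt : Fin p → ℝ) (y : I.Resp B) :
    M.jointDensity s I α z zt y = ∫⁻ a, normalDensity (jointCov M.corr s) (Sum.elim a.1 a.2) *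
      M.respDensity I y (M.predictors a.1) ∂((M.fibre α z).prod (M.fibre α zt)) :=
  (lintegral_prod _ (M.measurable_jointIntegrand s y).aemeasurable).symm

theorem measurable_jointDensity (s : Fin p → ℝ) (α : Finset (Fin p)) (y : I.Resp B) :
    Measurable fun a : (Fin p → ℝ) × (Fin p → ℝ) => M.jointDensity s I α a.1 a.2 y := by
  have hf : Measurable
      fun b : (((Fin p → ℝ) × (Fin p → ℝ)) × (Fin p → ℝ)) × (Fin p → ℝ) => (b.1.2, b.2) :=
    (measurable_snd.comp measurable_fst).prodMk measurable_snd
  have h2 : Measurable fun b : ((Fin p → ℝ) × (Fin p → ℝ)) × (Fin p → ℝ) => b.1.2 :=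
    measurable_snd.comp measurable_fst
  have h1 := M.measurable_lintegral_fibre α ((M.measurable_jointIntegrand s y).comp hf) h2
  exact M.measurable_lintegral_fibre α h1 measurable_fst

theorem obsDensity_congr {α : Finset (Fin p)} {z z' : Fin p → ℝ} (h : ∀ j ∈ α, z j = z' j)
    (y : I.Resp B) : M.obsDensity I α z y = M.obsDensity I α z' y := by
  unfold obsDensity
  rw [M.fibre_congr h]

theorem jointDensity_congr (s : Fin p → ℝ) {α : Finset (Fin p)} {z z' zt zt' : Fin p → ℝ}
    (h : ∀ j ∈ α, z j = z' j) (ht : ∀ j ∈ α, zt j = zt' j) (y : I.Resp B) :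
    M.jointDensity s I α z zt y = M.jointDensity s I α z' zt' y := by
  unfold jointDensity
  rw [M.fibre_congr h, M.fibre_congr ht]

/-- Together with finiteness, this ensures that no quotient of densities takes a default value at
attainable data. -/
theorem obsDensity_ne_zero {α : Finset (Fin p)} {z : Fin p → ℝ}
    (hz : ∀ j ∈ α, z j ∈ (kind j).values) (y : I.Resp B) : M.obsDensity I α z y ≠ 0 := by
  unfold obsDensity
  rw [Ne, lintegral_eq_zero_iff (M.measurable_obsIntegrand y)]
  intro h
  have := (ae_neBot.mpr (M.fibre_ne_zero hz))
  obtain ⟨x, hx⟩ := h.exists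
  exact mul_ne_zero (normalDensity_ne_zero M.corr_posDef x) (M.respDensity_ne_zero y _) hx

theorem obsDensity_ne_top (α : Finset (Fin p)) (z : Fin p → ℝ) (y : I.Resp B) :
    M.obsDensity I α z y ≠ ∞ := by
  obtain ⟨C, c, hC, hc, h⟩ := exists_normalDensity_le M.corr_posDef
  refine ne_top_of_le_ne_top
    (ENNReal.mul_ne_top hC (M.lintegral_exp_fibre_ne_top α z hc)) ?_
  rw [← lintegral_const_mul' _ _ hC]
  exact lintegral_mono fun x => (mul_le_of_le_one_right' (M.respDensity_le_one y _)).trans (h x)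

theorem jointDensity_ne_zero {s : Fin p → ℝ} (hs : (jointCov M.corr s).PosDef)
    {α : Finset (Fin p)} {z zt : Fin p → ℝ} (hz : ∀ j ∈ α, z j ∈ (kind j).values)
    (hzt : ∀ j ∈ α, zt j ∈ (kind j).values) (y : I.Resp B) :
    M.jointDensity s I α z zt y ≠ 0 := by
  rw [jointDensity_eq_lintegral_prod, Ne, lintegral_eq_zero_iff (M.measurable_jointIntegrand s y)]
  intro h
  have := ae_neBot.mpr (M.fibre_ne_zero hz)
  have := ae_neBot.mpr (M.fibre_ne_zero hzt)
  obtain ⟨x, hx⟩ := (Measure.ae_ae_of_ae_prod h).exists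
  obtain ⟨xt, hxt⟩ := hx.exists
  exact mul_ne_zero (normalDensity_ne_zero hs _) (M.respDensity_ne_zero y _) hxt

theorem jointDensity_ne_top {s : Fin p → ℝ} (hs : (jointCov M.corr s).PosDef)
    (α : Finset (Fin p)) (z zt : Fin p → ℝ) (y : I.Resp B) :
    M.jointDensity s I α z zt y ≠ ∞ := by
  obtain ⟨C, c, hC, hc, h⟩ := exists_normalDensity_le hs
  have hm : Measurable fun x : Fin p → ℝ => ∏ j, ENNReal.ofReal (Real.exp (-c * x j ^ 2)) :=
    Finset.measurable_prod _ fun j _ => by fun_prop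
  refine ne_top_of_le_ne_top (ENNReal.mul_ne_top hC (ENNReal.mul_ne_top
    (M.lintegral_exp_fibre_ne_top α z hc) (M.lintegral_exp_fibre_ne_top α zt hc))) ?_
  rw [jointDensity_eq_lintegral_prod, ← lintegral_prod_mul hm.aemeasurable hm.aemeasurable,
    ← lintegral_const_mul' _ _ hC]
  refine lintegral_mono fun a => (mul_le_of_le_one_right' (M.respDensity_le_one y _)).trans
    ((h _).trans_eq ?_)
  rw [Fintype.prod_sum_type]
  rfl

/-- Exchanging the `j`-th values exchanges the `j`-th fibres. Undoing this on the underlying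
variables leaves the Gaussian density unchanged by exchangeability, and the response density
unchanged since `j` has zero slope. -/
theorem jointDensity_swapPair {j : Fin p} (hj : j ∉ M.nonNull) (s : Fin p → ℝ)
    (α : Finset (Fin p)) (a : (Fin p → ℝ) × (Fin p → ℝ)) (y : I.Resp B) :
    M.jointDensity s I α (swapPair j a).1 (swapPair j a).2 y =
      M.jointDensity s I α a.1 a.2 y := by
  have hupd (z : Fin p → ℝ) (t : ℝ) : M.fibre α (Function.update z j t) =
      Measure.pi (Function.update (fun k => M.coordFibre α k (z k)) j (M.coordFibre α j t)) := by
    rw [fibre_eq]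
    congr 1
    funext k
    by_cases hk : k = j
    · subst hk; simp
    · simp [hk]
  have h := map_swapPair j (fun k => M.coordFibre α k (a.1 k)) fun k => M.coordFibre α k (a.2 k)
  rw [jointDensity_eq_lintegral_prod, jointDensity_eq_lintegral_prod]
  simp only [swapPair]
  rw [hupd, hupd, ← h, lintegral_map (M.measurable_jointIntegrand s y) (measurable_swapPair j)]
  refine lintegral_congr fun x => ?_
  rw [normalDensity_jointCov_swapPair]
  congr 1
  refine M.respDensity_update hj y fun k hk => ?_
  simp [predictors, swapPair, hk]

end Params

end Model

/-- The probability of the pattern `α` is a function of the entries observed under `α`, which makes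
the missingness ignorable. -/
theorem SMAR.eq_mask {p : ℕ} {S : Set (Fin p)} {q : (Fin p → ℝ) → PMF (Finset (Fin p))}
    (hq : SMAR S q) (α : Finset (Fin p)) (z : Fin p → ℝ) : q (mask α z) α = q z α :=
  hq α _ _ fun k hk _ => by simp [mask, hk]

/-! ### The law of the generated knockoffs given the observed data -/

section Model

variable {p : ℕ} {kind : Fin p → PredictorKind} {ι : Type*} {I : Items ι} {B : Finset ι}

namespace Params

variable (M : Params kind)

theorem measurable_knockoffDensity (s : Fin p → ℝ) (α : Finset (Fin p)) (y : I.Resp B) :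
    Measurable fun a : (Fin p → ℝ) × (Fin p → ℝ) => M.knockoffDensity s I α a.1 a.2 y :=
  (M.measurable_jointDensity s α y).div ((M.measurable_obsDensity α y).comp measurable_fst)

theorem measurable_jointIntegrand_ratio (s : Fin p → ℝ) :
    Measurable fun a : (Fin p → ℝ) × (Fin p → ℝ) =>
      normalDensity (jointCov M.corr s) (Sum.elim a.1 a.2) / normalDensity M.corr a.1 := by
  have : Measurable fun a : (Fin p → ℝ) × (Fin p → ℝ) => Sum.elim a.1 a.2 := by
    refine measurable_pi_lambda _ fun k => ?_
    rcases k with k | k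
    · exact (measurable_pi_apply k).comp measurable_fst
    · exact (measurable_pi_apply k).comp measurable_snd
  exact ((measurable_normalDensity _).comp this).div
    ((measurable_normalDensity _).comp measurable_fst)

theorem lintegral_knockoffKernel (s x : Fin p → ℝ) {g : (Fin p → ℝ) → ℝ≥0∞} (hg : Measurable g) :
    ∫⁻ xt, g xt ∂(M.knockoffKernel s x) =
      ∫⁻ xt, normalDensity (jointCov M.corr s) (Sum.elim x xt) / normalDensity M.corr x * g xt := by
  have : Measurable fun xt => normalDensity (jointCov M.corr s) (Sum.elim x xt) /
      normalDensity M.corr x := by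
    have hx : Measurable fun xt : Fin p → ℝ => (x, xt) := measurable_prodMk_left
    have h := (M.measurable_jointIntegrand_ratio s).comp hx
    exact h
  rw [knockoffKernel, lintegral_withDensity_mul _ this hg]

theorem measurable_lintegral_knockoffKernel (s : Fin p → ℝ) {T : Type*} [MeasurableSpace T]
    {g : T × (Fin p → ℝ) → ℝ≥0∞} (hg : Measurable g) {ξ : T → Fin p → ℝ} (hξ : Measurable ξ) :
    Measurable fun t => ∫⁻ xt, g (t, xt) ∂(M.knockoffKernel s (ξ t)) := by
  have h1 : (fun t => ∫⁻ xt, g (t, xt) ∂(M.knockoffKernel s (ξ t))) = fun t => ∫⁻ xt,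
      normalDensity (jointCov M.corr s) (Sum.elim (ξ t) xt) / normalDensity M.corr (ξ t) *
        g (t, xt) := by
    funext t
    exact M.lintegral_knockoffKernel s (ξ t) (hg.comp measurable_prodMk_left)
  have h2 : Measurable fun a : T × (Fin p → ℝ) => (ξ a.1, a.2) :=
    (hξ.comp measurable_fst).prodMk measurable_snd
  rw [h1]
  exact (((M.measurable_jointIntegrand_ratio s).comp h2).mul hg).lintegral_prod_right'

/-- The knockoffs generated from the observed data have density `Params.knockoffDensity`. -/
theorem lintegral_latentPosterior_knockoffKernel (s : Fin p → ℝ) (α : Finset (Fin p))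
    (z : Fin p → ℝ) (y : I.Resp B) {g : (Fin p → ℝ) → ℝ≥0∞} (hg : Measurable g) :
    ∫⁻ x, ∫⁻ xt, g (mask α (M.predictors xt)) ∂(M.knockoffKernel s x)
        ∂(M.latentPosterior I α z y) =
      ∫⁻ zt, g zt * M.knockoffDensity s I α z zt y ∂(refMeasure kind α) := by
  have hgm : Measurable fun xt => g (mask α (M.predictors xt)) :=
    hg.comp ((measurable_mask α).comp M.measurable_predictors)
  have hin : Measurable fun x => ∫⁻ xt, g (mask α (M.predictors xt)) ∂(M.knockoffKernel s x) :=
    M.measurable_lintegral_knockoffKernel s (hgm.comp measurable_snd) measurable_id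
  have hJ := M.measurable_jointIntegrand s y
  have hJx (x : Fin p → ℝ) : Measurable fun xt =>
      normalDensity (jointCov M.corr s) (Sum.elim x xt) * M.respDensity I y (M.predictors x) := by
    have hx : Measurable fun xt : Fin p → ℝ => (x, xt) := measurable_prodMk_left
    have h := hJ.comp hx
    exact h
  -- The Gaussian density of `x` in the posterior cancels the denominator of the knockoff kernel,
  -- leaving the joint Gaussian density; Lebesgue measure in `xt` is then disintegrated over the
  -- observed knockoff values.
  have hpt (x : Fin p → ℝ) :
      (normalDensity M.corr x * M.respDensity I y (M.predictors x)) *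
        ∫⁻ xt, g (mask α (M.predictors xt)) ∂(M.knockoffKernel s x) =
      ∫⁻ zt, g zt * ∫⁻ xt, normalDensity (jointCov M.corr s) (Sum.elim x xt) *
        M.respDensity I y (M.predictors x) ∂(M.fibre α zt) ∂(refMeasure kind α) := by
    rw [M.lintegral_knockoffKernel s x hgm, ← lintegral_const_mul' _ _
      (ENNReal.mul_ne_top (normalDensity_ne_top _ _)
        (ne_top_of_le_ne_top ENNReal.one_ne_top (M.respDensity_le_one y _)))]
    have : ∀ xt, normalDensity M.corr x * M.respDensity I y (M.predictors x) *
        (normalDensity (jointCov M.corr s) (Sum.elim x xt) / normalDensity M.corr x *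
          g (mask α (M.predictors xt))) =
        g (mask α (M.predictors xt)) * (normalDensity (jointCov M.corr s) (Sum.elim x xt) *
          M.respDensity I y (M.predictors x)) := fun xt => by
      calc _ = (normalDensity M.corr x * (normalDensity (jointCov M.corr s) (Sum.elim x xt) /
            normalDensity M.corr x)) * (M.respDensity I y (M.predictors x) *
              g (mask α (M.predictors xt))) := by ring
        _ = _ := by
          rw [ENNReal.mul_div_cancel (normalDensity_ne_zero M.corr_posDef x)
            (normalDensity_ne_top _ _)]
          ring
    simp_rw [this]
    have hgJ : Measurable fun xt => g (mask α (M.predictors xt)) *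
        (normalDensity (jointCov M.corr s) (Sum.elim x xt) *
          M.respDensity I y (M.predictors x)) := hgm.mul (hJx x)
    rw [← M.lintegral_lintegral_fibre α hgJ]
    refine lintegral_congr_ae ?_
    filter_upwards [M.ae_fibre α] with zt hzt
    rw [← lintegral_const_mul _ (hJx x)]
    refine lintegral_congr_ae ?_
    filter_upwards [hzt] with xt hxt
    rw [hxt]
  have hf : Measurable
      fun b : ((Fin p → ℝ) × (Fin p → ℝ)) × (Fin p → ℝ) => (b.1.1, b.2) :=
    (measurable_fst.comp measurable_fst).prodMk measurable_snd
  have hswap : Measurable fun a : (Fin p → ℝ) × (Fin p → ℝ) =>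
      g a.2 * ∫⁻ xt, normalDensity (jointCov M.corr s) (Sum.elim a.1 xt) *
        M.respDensity I y (M.predictors a.1) ∂(M.fibre α a.2) :=
    (hg.comp measurable_snd).mul
      (M.measurable_lintegral_fibre α (hJ.comp hf) measurable_snd)
  have hinner (zt : Fin p → ℝ) : Measurable fun x =>
      ∫⁻ xt, normalDensity (jointCov M.corr s) (Sum.elim x xt) *
        M.respDensity I y (M.predictors x) ∂(M.fibre α zt) :=
    M.measurable_lintegral_fibre α hJ measurable_const
  have hdens := lintegral_withDensity_mul (M.fibre α z)
    (M.measurable_obsIntegrand y) hin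
  have hjoint : Measurable fun zt => M.jointDensity s I α z zt y :=
    (M.measurable_jointDensity s α y).comp measurable_prodMk_left
  rw [latentPosterior, lintegral_smul_measure, hdens]
  simp_rw [hpt]
  rw [lintegral_lintegral_swap hswap.aemeasurable]
  simp_rw [lintegral_const_mul _ (hinner _)]
  change (M.obsDensity I α z y)⁻¹ • ∫⁻ zt, g zt * M.jointDensity s I α z zt y
    ∂(refMeasure kind α) = _
  have hgj : Measurable fun zt => g zt * M.jointDensity s I α z zt y := hg.mul hjoint
  rw [smul_eq_mul, ← lintegral_const_mul _ hgj]
  refine lintegral_congr fun zt => ?_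
  rw [knockoffDensity, div_eq_mul_inv]
  ring

end Params

/-! ### The joint law of the data of a student -/

instance : Fintype (I.Resp B) := Fintype.ofFinite _

variable (I B) in
/-- The possible missingness patterns, observed predictors, observed knockoffs and responses of a
student. -/
abbrev StudentData (p : ℕ) : Type _ :=
  Finset (Fin p) × ((Fin p → ℝ) × (Fin p → ℝ)) × I.Resp B

variable (I B) in
/-- The measure with respect to which the data of a student have a density. -/
def dataRefMeasure (kind : Fin p → PredictorKind) : Measure (StudentData I B p) :=
  Measure.sum fun a : Finset (Fin p) × I.Resp B =>
    (Measure.dirac a.1).prod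
      (((refMeasure kind a.1).prod (refMeasure kind a.1)).prod (Measure.dirac a.2))

instance : SigmaFinite (dataRefMeasure I B kind) := by
  unfold dataRefMeasure; infer_instance

theorem lintegral_dataRefMeasure {F : StudentData I B p → ℝ≥0∞} (hF : Measurable F) :
    ∫⁻ e, F e ∂(dataRefMeasure I B kind) = ∑ α, ∑ y, ∫⁻ a, F (α, a, y)
      ∂((refMeasure kind α).prod (refMeasure kind α)) := by
  unfold dataRefMeasure
  rw [lintegral_sum_measure, tsum_fintype, Fintype.sum_prod_type]
  refine Finset.sum_congr rfl fun α _ => Finset.sum_congr rfl fun y _ => ?_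
  have h1 : Measurable fun b => F (α, b) := hF.comp measurable_prodMk_left
  rw [lintegral_prod _ hF.aemeasurable, lintegral_dirac, lintegral_prod _ h1.aemeasurable]
  refine lintegral_congr fun a => ?_
  rw [lintegral_dirac]

theorem measurable_studentData {G : StudentData I B p → ℝ≥0∞}
    (h : ∀ α y, Measurable fun a => G (α, a, y)) : Measurable G := by
  refine measurable_from_prod_countable_right fun α => ?_
  exact measurable_from_prod_countable_left fun y => h α y

/-- The exchange of the observed predictor `j` and its knockoff. -/
def swapData (j : Fin p) (e : StudentData I B p) : StudentData I B p :=
  (e.1, swapPair j e.2.1, e.2.2)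

/-- For each pattern, `Z_j` and its knockoff have the same reference measure: that of the predictor
if `j` is observed, the point mass at `0` otherwise. -/
theorem measurePreserving_swapData (j : Fin p) :
    MeasurePreserving (swapData j) (dataRefMeasure I B kind) (dataRefMeasure I B kind) := by
  have hm : Measurable (swapData j : StudentData I B p → _) :=
    measurable_fst.prodMk (((measurable_swapPair j).comp
      (measurable_fst.comp measurable_snd)).prodMk (measurable_snd.comp measurable_snd))
  refine ⟨hm, Measure.ext_of_lintegral _ fun F hF => ?_⟩
  rw [lintegral_map hF hm, lintegral_dataRefMeasure (F := fun e => F (swapData j e)) (hF.comp hm), lintegral_dataRefMeasure hF]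
  refine Finset.sum_congr rfl fun α _ => Finset.sum_congr rfl fun y _ => ?_
  have h := map_swapPair j (fun k => if k ∈ α then (kind k).refMeasure else Measure.dirac 0)
    fun k => if k ∈ α then (kind k).refMeasure else Measure.dirac 0
  rw [Function.update_eq_self] at h
  have h1 : Measurable fun a => F (α, a, y) :=
    hF.comp (measurable_prodMk_left.comp measurable_prodMk_right)
  conv_rhs => rw [refMeasure, ← h, lintegral_map h1 (measurable_swapPair j)]
  rfl

/-- The density of the data of a student. -/
def dataDensity (P Q : Params kind) (s : Fin p → ℝ) (q : (Fin p → ℝ) → PMF (Finset (Fin p)))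
    (e : StudentData I B p) : ℝ≥0∞ :=
  q e.2.1.1 e.1 * P.obsDensity I e.1 e.2.1.1 e.2.2 *
    Q.knockoffDensity s I e.1 e.2.1.1 e.2.1.2 e.2.2

theorem measurable_dataDensity (P Q : Params kind) (s : Fin p → ℝ)
    {q : (Fin p → ℝ) → PMF (Finset (Fin p))} (hq : ∀ α, Measurable fun z => q z α) :
    Measurable (dataDensity P Q s q : StudentData I B p → ℝ≥0∞) :=
  measurable_studentData fun α y => (((hq α).comp measurable_fst).mul
    ((P.measurable_obsDensity α y).comp measurable_fst)).mul (Q.measurable_knockoffDensity s α y)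

/-- A test function is integrated by peeling off the conditional laws in reverse order of
generation, ending with the Gaussian law of the underlying variables, which is disintegrated over
the observed predictor values. -/
theorem map_studentData {Ω : Type*} [MeasurableSpace Ω] (μ : Measure Ω) [IsProbabilityMeasure μ]
    (P Q : Params kind) (s : Fin p → ℝ) {q : (Fin p → ℝ) → PMF (Finset (Fin p))}
    (hq_meas : ∀ α, Measurable fun z => q z α) (hq : SMAR P.nonNull q)
    {X : Ω → Fin p → ℝ} {Θ : Ω → ℝ} {Y : Ω → I.Resp B} {A : Ω → Finset (Fin p)}
    {Xs Xt : Ω → Fin p → ℝ} (hX : Measurable X) (hΘ : Measurable Θ) (hY : Measurable Y)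
    (hA : Measurable A) (hXs : Measurable Xs) (hXt : Measurable Xt)
    (law_X : μ.map X = volume.withDensity (normalDensity P.corr))
    (law_Θ : HasCondLaw Θ (fun ω => P.predictors (X ω))
      (fun z => gaussianReal (P.abilityMean z) P.resVar) μ)
    (law_Y : HasCondLaw Y (fun ω => (P.predictors (X ω), Θ ω))
      (fun d => Measure.count.withDensity (fun y => I.respProb d.2 y)) μ)
    (law_A : HasCondLaw A (fun ω => (P.predictors (X ω), Y ω)) (fun d => (q d.1).toMeasure) μ)
    (law_Xs : HasCondLaw Xs (fun ω => (A ω, mask (A ω) (P.predictors (X ω)), Y ω))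
      (fun d => Q.latentPosterior I d.1 d.2.1 d.2.2) μ)
    (law_Xt : HasCondLaw Xt (fun ω => ((A ω, mask (A ω) (P.predictors (X ω)), Y ω), Xs ω))
      (fun d => Q.knockoffKernel s d.2) μ) :
    μ.map (fun ω => ((A ω, (mask (A ω) (P.predictors (X ω)), mask (A ω) (Q.predictors (Xt ω))),
        Y ω) : StudentData I B p)) =
      (dataRefMeasure I B kind).withDensity (dataDensity P Q s q) := by
  have hmask : Measurable fun b : Finset (Fin p) × (Fin p → ℝ) => mask b.1 b.2 :=
    measurable_from_prod_countable_right fun α => measurable_mask α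
  have hZ : Measurable fun ω => P.predictors (X ω) := P.measurable_predictors.comp hX
  have hmZ : Measurable fun ω => mask (A ω) (P.predictors (X ω)) := hmask.comp (hA.prodMk hZ)
  have hmZt : Measurable fun ω => mask (A ω) (Q.predictors (Xt ω)) :=
    hmask.comp (hA.prodMk (Q.measurable_predictors.comp hXt))
  have hD : Measurable fun ω => (A ω, mask (A ω) (P.predictors (X ω)), Y ω) :=
    hA.prodMk (hmZ.prodMk hY)
  refine Measure.ext_of_lintegral _ fun h hh => ?_
  have hfm := measurable_dataDensity (I := I) (B := B) P Q s hq_meas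
  rw [lintegral_map hh (hA.prodMk ((hmZ.prodMk hmZt).prodMk hY))]
  have hdens := lintegral_withDensity_mul (dataRefMeasure I B kind) hfm hh
  rw [hdens, lintegral_dataRefMeasure (F := fun e => dataDensity P Q s q e * h e) (hfm.mul hh)]
  -- The conditional expectation of the test function given the observed predictors and responses.
  let H : Finset (Fin p) → (Fin p → ℝ) → I.Resp B → ℝ≥0∞ := fun α z y =>
    ∫⁻ zt, h (α, (z, zt), y) * Q.knockoffDensity s I α z zt y ∂(refMeasure kind α)
  have hhα (α : Finset (Fin p)) (y : I.Resp B) :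
      Measurable fun a : (Fin p → ℝ) × (Fin p → ℝ) => h (α, a, y) :=
    hh.comp (measurable_prodMk_left.comp measurable_prodMk_right)
  have hHm (α : Finset (Fin p)) (y : I.Resp B) : Measurable fun z => H α z y :=
    ((hhα α y).mul (Q.measurable_knockoffDensity s α y)).lintegral_prod_right'
  -- the knockoffs
  have step1 : ∫⁻ ω, h (A ω, (mask (A ω) (P.predictors (X ω)), mask (A ω) (Q.predictors (Xt ω))),
      Y ω) ∂μ = ∫⁻ ω, H (A ω) (mask (A ω) (P.predictors (X ω))) (Y ω) ∂μ := by
    have hg : Measurable fun b :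
        ((Finset (Fin p) × (Fin p → ℝ) × I.Resp B) × (Fin p → ℝ)) × (Fin p → ℝ) =>
        h (b.1.1.1, (b.1.1.2.1, mask b.1.1.1 (Q.predictors b.2)), b.1.1.2.2) := by
      have h1 : Measurable fun b :
        ((Finset (Fin p) × (Fin p → ℝ) × I.Resp B) × (Fin p → ℝ)) × (Fin p → ℝ) =>
          mask b.1.1.1 (Q.predictors b.2) :=
        hmask.comp ((measurable_fst.comp (measurable_fst.comp measurable_fst)).prodMk (Q.measurable_predictors.comp measurable_snd))
      exact hh.comp (by fun_prop)
    rw [law_Xt.lintegral_eq hXt (hD.prodMk hXs) hg]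
    rw [law_Xs.lintegral_eq hXs hD
      (Q.measurable_lintegral_knockoffKernel s hg measurable_snd)]
    refine lintegral_congr fun ω => ?_
    exact Q.lintegral_latentPosterior_knockoffKernel s (A ω) _ (Y ω)
      ((hhα (A ω) (Y ω)).comp measurable_prodMk_left)
  rw [step1]
  -- the missingness pattern, the responses and the ability
  have hHmask (α : Finset (Fin p)) (y : I.Resp B) : Measurable fun z => H α (mask α z) y :=
    (hHm α y).comp (measurable_mask α)
  have hHA : Measurable fun b : ((Fin p → ℝ) × I.Resp B) × Finset (Fin p) =>
      H b.2 (mask b.2 b.1.1) b.1.2 :=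
    measurable_from_prod_countable_left fun α =>
      measurable_from_prod_countable_left fun y => hHmask α y
  rw [law_A.lintegral_eq hA (hZ.prodMk hY) hHA]
  simp only [lintegral_fintype, PMF.toMeasure_apply_singleton _ _ (measurableSet_singleton _)]
  have hGα (α : Finset (Fin p)) (y : I.Resp B) :
      Measurable fun z => H α (mask α z) y * q z α := (hHmask α y).mul (hq_meas α)
  have hG (y : I.Resp B) : Measurable fun z => ∑ α, H α (mask α z) y * q z α :=
    Finset.measurable_sum _ fun α _ => hGα α y
  have hGY : Measurable fun b : ((Fin p → ℝ) × ℝ) × I.Resp B =>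
      ∑ α, H α (mask α b.1.1) b.2 * q b.1.1 α :=
    measurable_from_prod_countable_left fun y => (hG y).comp measurable_fst
  rw [law_Y.lintegral_eq hY (hZ.prodMk hΘ) hGY]
  have hcount (t : ℝ) (g : I.Resp B → ℝ≥0∞) :
      ∫⁻ y, g y ∂(Measure.count.withDensity fun y => I.respProb t y) =
        ∑ y, I.respProb t y * g y := by
    rw [lintegral_withDensity_mul _ (measurable_of_countable _)
      (measurable_of_countable _), lintegral_count, tsum_fintype]
  simp_rw [hcount]
  have hrp (y : I.Resp B) : Measurable fun b : (Fin p → ℝ) × ℝ => I.respProb b.2 y *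
      ∑ α, H α (mask α b.1) y * q b.1 α :=
    ((Items.measurable_respProb y).comp measurable_snd).mul ((hG y).comp measurable_fst)
  rw [law_Θ.lintegral_eq hΘ hZ (g := fun b => ∑ y, I.respProb b.2 y *
      ∑ α, H α (mask α b.1) y * q b.1 α) (Finset.measurable_sum _ fun y _ => hrp y)]
  -- Only the response probabilities involve the ability, so integrating it out produces
  -- `respDensity`.
  have hgauss (z : Fin p → ℝ) : ∫⁻ t, ∑ y, I.respProb t y * ∑ α, H α (mask α z) y * q z α
      ∂(gaussianReal (P.abilityMean z) P.resVar) =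
        ∑ y, ∑ α, P.respDensity I y z * (H α (mask α z) y * q z α) := by
    rw [lintegral_finsetSum _ fun y _ => (Items.measurable_respProb y).mul_const _]
    refine Finset.sum_congr rfl fun y _ => ?_
    rw [lintegral_mul_const _ (Items.measurable_respProb y), Finset.mul_sum]
    rfl
  simp_rw [hgauss]
  -- the predictors
  have hTm (y : I.Resp B) (α : Finset (Fin p)) : Measurable fun x =>
      P.respDensity I y (P.predictors x) *
        (H α (mask α (P.predictors x)) y * q (P.predictors x) α) :=
    ((P.measurable_respDensity y).mul (hGα α y)).comp P.measurable_predictors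
  have hSm : Measurable fun x => ∑ y, ∑ α, P.respDensity I y (P.predictors x) *
      (H α (mask α (P.predictors x)) y * q (P.predictors x) α) :=
    Finset.measurable_sum _ fun y _ => Finset.measurable_sum _ fun α _ => hTm y α
  have hNT (y : I.Resp B) (α : Finset (Fin p)) : Measurable fun x => normalDensity P.corr x *
      (P.respDensity I y (P.predictors x) *
        (H α (mask α (P.predictors x)) y * q (P.predictors x) α)) :=
    (measurable_normalDensity _).mul (hTm y α)
  rw [← lintegral_map hSm hX, law_X,
    lintegral_withDensity_mul _ (measurable_normalDensity _) hSm]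
  simp only [Finset.mul_sum]
  rw [lintegral_finsetSum _ fun y _ => Finset.measurable_sum _ fun α _ => hNT y α]
  simp_rw [lintegral_finsetSum _ fun α _ => hNT _ α]
  rw [Finset.sum_comm]
  refine Finset.sum_congr rfl fun α _ => Finset.sum_congr rfl fun y _ => ?_
  have hfh : Measurable fun a : (Fin p → ℝ) × (Fin p → ℝ) =>
      dataDensity P Q s q (α, a, y) * h (α, a, y) :=
    (hfm.comp (measurable_prodMk_left.comp measurable_prodMk_right)).mul (hhα α y)
  rw [← P.lintegral_lintegral_fibre α (hNT y α), lintegral_prod _ hfh.aemeasurable]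
  refine lintegral_congr_ae ?_
  filter_upwards [P.ae_fibre α] with z hz
  have hobs := P.measurable_obsIntegrand y
  have hz1 : ∫⁻ x, normalDensity P.corr x * (P.respDensity I y (P.predictors x) *
      (H α (mask α (P.predictors x)) y * q (P.predictors x) α)) ∂(P.fibre α z) =
      P.obsDensity I α z y * (H α z y * q z α) := by
    unfold Params.obsDensity
    rw [← lintegral_mul_const _ hobs]
    refine lintegral_congr_ae ?_
    filter_upwards [hz] with x hx
    -- SMAR turns the missingness probability at the complete predictors into its value at `z`, a
    -- constant on the fibre.
    rw [← hq.eq_mask α (P.predictors x), hx, mul_assoc]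
  have hk : Measurable fun zt => h (α, (z, zt), y) * Q.knockoffDensity s I α z zt y :=
    ((hhα α y).mul (Q.measurable_knockoffDensity s α y)).comp measurable_prodMk_left
  refine hz1.trans ?_
  rw [mul_comm (H α z y), ← mul_assoc, ← lintegral_const_mul _ hk]
  refine lintegral_congr fun zt => ?_
  simp only [dataDensity]
  ring

end Model

/-! ### Change of measure -/

/-- Bound the density on `S` by `c` times its value at the transformed point, which lies in `T`;
then substitute, as the reference measure is invariant. -/
theorem pi_withDensity_le_of_measurePreserving {n : Type*} [Fintype n] {E : n → Type*}
    [∀ i, MeasurableSpace (E i)] (m : ∀ i, Measure (E i)) [∀ i, SigmaFinite (m i)]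
    {f : ∀ i, E i → ℝ≥0∞} (hf : ∀ i, Measurable (f i))
    [∀ i, SigmaFinite ((m i).withDensity (f i))] {σ : ∀ i, E i → E i}
    (hσ : ∀ i, MeasurePreserving (σ i) (m i) (m i)) {S T : Set (∀ i, E i)}
    (hS : MeasurableSet S) (hT : MeasurableSet T) {c : ℝ≥0∞} (hc : c ≠ ∞)
    (hST : ∀ d ∈ S, (fun i => σ i (d i)) ∈ T ∧ ∏ i, f i (d i) ≤ c * ∏ i, f i (σ i (d i))) :
    Measure.pi (fun i => (m i).withDensity (f i)) S ≤
      c * Measure.pi (fun i => (m i).withDensity (f i)) T := by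
  have hF : Measurable fun d : ∀ i, E i => ∏ i, f i (d i) :=
    Finset.measurable_prod _ fun i _ => (hf i).comp (measurable_pi_apply i)
  have hmp := measurePreserving_pi m m hσ
  rw [pi_withDensity m hf, withDensity_apply _ hS, withDensity_apply _ hT,
    ← lintegral_indicator hS, ← lintegral_indicator hT, ← lintegral_const_mul' _ _ hc,
    ← hmp.lintegral_comp ((hF.indicator hT).const_mul c)]
  refine lintegral_mono fun d => ?_
  by_cases hd : d ∈ S
  · rw [Set.indicator_of_mem hd, Set.indicator_of_mem (hST d hd).1]
    exact (hST d hd).2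
  · rw [Set.indicator_of_notMem hd]
    exact zero_le

/-! ### The threshold -/

section Threshold

variable {p : ℕ} {ν : ℕ}

theorem threshold_lt_iff (hν : 1 ≤ ν) (W : Fin p → ℝ) (c : ℝ) :
    threshold ν W < c ↔
      ∃ t : ℝ, (0 < t ∧ 1 + (Finset.univ.filter fun j => W j < -t).card ≤ ν) ∧ t < c := by
  refine csInf_lt_iff ⟨0, fun t ht => ht.1.le⟩ ?_
  obtain ⟨m, hm⟩ := (Set.finite_range fun j => |W j|).bddAbove
  -- Beyond all magnitudes nothing is counted, so the condition reads `1 ≤ ν`.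
  refine ⟨max m 0 + 1, by positivity, ?_⟩
  rw [Finset.card_eq_zero.mpr]
  · simpa using hν
  · refine Finset.filter_eq_empty_iff.mpr fun j _ => not_lt.mpr ?_
    have h1 : |W j| ≤ m := hm ⟨j, rfl⟩
    have h2 := neg_abs_le (W j)
    have h3 := le_max_left m 0
    linarith

theorem threshold_nonneg (W : Fin p → ℝ) : 0 ≤ threshold ν W :=
  Real.sInf_nonneg fun _ ht => ht.1.le

/-- The count decreases in `t`, so an admissible `t < c` may be increased to a rational one. -/
theorem measurableSet_threshold_lt (hν : 1 ≤ ν) {E : Type*} [MeasurableSpace E]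
    {W : E → Fin p → ℝ} (hW : Measurable W) {c : E → ℝ} (hc : Measurable c) :
    MeasurableSet {e | threshold ν (W e) < c e} := by
  have h1 : {e | threshold ν (W e) < c e} = ⋃ r : ℚ, {e | (0 : ℝ) < r ∧
      1 + ∑ j, (if W e j < -(r : ℝ) then 1 else 0) ≤ ν ∧ (r : ℝ) < c e} := by
    ext e
    simp only [Set.mem_ofPred_eq, Set.mem_iUnion, threshold_lt_iff hν, ← Finset.card_filter]
    constructor
    · rintro ⟨t, ⟨ht, htν⟩, htc⟩
      obtain ⟨r, htr, hrc⟩ := exists_rat_btwn htc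
      refine ⟨r, ht.trans htr, le_trans (Nat.add_le_add_left (Finset.card_le_card ?_) 1) htν, hrc⟩
      refine Finset.monotone_filter_right _ fun j _ (hj : W e j < -(r : ℝ)) => ?_
      linarith
    · rintro ⟨r, hr, hrν, hrc⟩
      exact ⟨r, ⟨hr, hrν⟩, hrc⟩
  rw [h1]
  refine MeasurableSet.iUnion fun r => ?_
  have h2 : Measurable fun e => 1 + ∑ j, (if W e j < -(r : ℝ) then 1 else 0 : ℕ) :=
    (Finset.measurable_sum _ fun j _ => Measurable.ite
      (measurableSet_lt ((measurable_pi_apply j).comp hW) measurable_const)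
      measurable_const measurable_const).const_add 1
  exact (MeasurableSet.const _).inter
    ((measurableSet_le h2 measurable_const).inter (measurableSet_lt measurable_const hc))

/-- The magnitude of the statistic `W j` exceeds the threshold computed with `|W j|` in place
of `W j`. -/
def ExceedsThreshold (ν : ℕ) (W : Fin p → ℝ) (j : Fin p) : Prop :=
  threshold ν (Function.update W j |W j|) < |W j|

theorem pos_and_exceedsThreshold_of_mem_selected {W : Fin p → ℝ} {j : Fin p}
    (h : j ∈ selected ν W) : 0 < W j ∧ ExceedsThreshold ν W j := by
  have h' : threshold ν W < W j := h
  have hpos : 0 < W j := (threshold_nonneg W).trans_lt h'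
  refine ⟨hpos, ?_⟩
  rw [ExceedsThreshold, abs_of_pos hpos, Function.update_eq_self]
  exact h'

open Classical in
-- Take the member `j` of the set whose statistic is closest to zero. Some admissible `t` for its
-- modified threshold is below `|W j|`, hence all other members have statistics below `-t` and are
-- counted there. The summand `1` in the threshold accounts for `j` itself.
theorem card_neg_and_exceedsThreshold_le (hν : 1 ≤ ν) (W : Fin p → ℝ) :
    (Finset.univ.filter fun j => W j < 0 ∧ ExceedsThreshold ν W j).card ≤ ν := by
  set J := Finset.univ.filter fun j => W j < 0 ∧ ExceedsThreshold ν W j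
  rcases J.eq_empty_or_nonempty with hJ | hJ
  · simp [hJ]
  obtain ⟨j, hj, hmax⟩ := J.exists_max_image W hJ
  obtain ⟨hneg, hex⟩ := (Finset.mem_filter.mp hj).2
  obtain ⟨t, ⟨_, htν⟩, htj⟩ := (threshold_lt_iff hν _ _).mp hex
  rw [abs_of_neg hneg] at htν htj
  have hsub : J.erase j ⊆
      Finset.univ.filter fun k => Function.update W j (-W j) k < -t := fun k hk => by
    have hk' := Finset.mem_erase.mp hk
    have := hmax k hk'.2
    rw [Finset.mem_filter, Function.update_of_ne hk'.1]
    exact ⟨Finset.mem_univ _, by linarith⟩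
  have h1 := Finset.card_le_card hsub
  have h2 := Finset.card_erase_add_one hj
  omega

theorem exceedsThreshold_neg_iff {W W' : Fin p → ℝ} {j : Fin p} (hj : W' j = -W j)
    (h : ∀ k, k ≠ j → W' k = W k) : ExceedsThreshold ν W' j ↔ ExceedsThreshold ν W j := by
  have : Function.update W' j |W j| = Function.update W j |W j| := by
    funext k
    by_cases hk : k = j
    · subst hk; simp
    · simp [hk, h k hk]
  rw [ExceedsThreshold, ExceedsThreshold, hj, abs_neg, this]

end Threshold

/-! ### Likelihood ratios -/

section Model

variable {p : ℕ} {kind : Fin p → PredictorKind} {ι : Type*} {I : Items ι}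

theorem div_mul_div_mul_cancel_of_ne {a b k a' k' : ℝ≥0∞} (hb : b ≠ 0) (hb' : b ≠ ∞)
    (h : a' * k' ≠ 0) (h' : a' * k' ≠ ∞) :
    a / b * k / (a' / b * k') * (a' * k') = a * k := by
  have e (x w : ℝ≥0∞) : x / b * w = x * w * b⁻¹ := by rw [div_eq_mul_inv]; ring
  rw [e, e, ENNReal.mul_div_mul_right _ _ (ENNReal.inv_ne_zero.mpr hb')
    (ENNReal.inv_ne_top.mpr hb), ENNReal.div_mul_cancel h h']

section Student

variable {B : Finset ι}

theorem dataDensity_congr (P Q : Params kind) (s : Fin p → ℝ)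
    {q : (Fin p → ℝ) → PMF (Finset (Fin p))} (hq : SMAR P.nonNull q) {α : Finset (Fin p)}
    {z z' zt zt' : Fin p → ℝ} (hz : ∀ k ∈ α, z k = z' k) (hzt : ∀ k ∈ α, zt k = zt' k)
    (y : I.Resp B) :
    dataDensity P Q s q (α, (z, zt), y) = dataDensity P Q s q (α, (z', zt'), y) := by
  simp only [dataDensity, Params.knockoffDensity]
  rw [hq α z z' fun k hk _ => hz k hk, P.obsDensity_congr hz, Q.obsDensity_congr hz,
    Q.jointDensity_congr s hz hzt]

variable {P Q : Params kind} {s : Fin p → ℝ} {q : (Fin p → ℝ) → PMF (Finset (Fin p))}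

theorem dataDensity_mask_eq_of_notMem (hq : SMAR P.nonNull q) {α : Finset (Fin p)} {j : Fin p}
    (hj : j ∉ α) (z zt : Fin p → ℝ) (y : I.Resp B) :
    dataDensity P Q s q (α, (mask α z, mask α zt), y) =
      dataDensity P Q s q (swapData j (α, (mask α z, mask α zt), y)) := by
  refine dataDensity_congr P Q s hq ?_ ?_ y <;>
  · intro k hk
    have : k ≠ j := by rintro rfl; exact hj hk
    simp [this]

variable (P Q s) in
/-- The likelihood ratio of the data of a student and the data with the observed predictor `j`
and its knockoff exchanged. -/
def swapRatio (α : Finset (Fin p)) (z zt : Fin p → ℝ) (y : I.Resp B) (j : Fin p) : ℝ≥0∞ :=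
  (P.condDensity I α j z y * Q.knockoffDensity s I α z zt y) /
    (P.condDensity I α j (Function.update z j (zt j)) y *
      Q.knockoffDensity s I α (Function.update z j (zt j)) (Function.update zt j (z j)) y)

theorem update_mem_values {z zt : Fin p → ℝ} (hz : ∀ k, z k ∈ (kind k).values)
    (hzt : ∀ k, zt k ∈ (kind k).values) (j k : Fin p) :
    Function.update z j (zt j) k ∈ (kind k).values := by
  by_cases h : k = j
  · subst h; simpa using hzt k
  · simpa [h] using hz k

theorem Params.knockoffDensity_ne_zero (hs : (jointCov Q.corr s).PosDef) (α : Finset (Fin p))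
    {z zt : Fin p → ℝ} (hz : ∀ k, z k ∈ (kind k).values) (hzt : ∀ k, zt k ∈ (kind k).values)
    (y : I.Resp B) : Q.knockoffDensity s I α z zt y ≠ 0 :=
  (ENNReal.div_pos (Q.jointDensity_ne_zero hs (fun k _ => hz k) (fun k _ => hzt k) y)
    (Q.obsDensity_ne_top α z y)).ne'

theorem Params.knockoffDensity_ne_top (hs : (jointCov Q.corr s).PosDef) (α : Finset (Fin p))
    {z zt : Fin p → ℝ} (hz : ∀ k, z k ∈ (kind k).values) (y : I.Resp B) :
    Q.knockoffDensity s I α z zt y ≠ ∞ :=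
  ENNReal.div_ne_top (Q.jointDensity_ne_top hs α z zt y)
    (Q.obsDensity_ne_zero (fun k _ => hz k) y)

theorem Params.obsDensity_erase_update (M : Params kind) (α : Finset (Fin p)) (j : Fin p)
    (z : Fin p → ℝ) (t : ℝ) (y : I.Resp B) :
    M.obsDensity I (α.erase j) (Function.update z j t) y = M.obsDensity I (α.erase j) z y :=
  M.obsDensity_congr (fun k hk => by simp [(Finset.mem_erase.mp hk).1]) y

/-- Both conditional densities of `Z_j` have the same denominator, which does not see entry `j`, so
it cancels from the ratio. -/
theorem swapRatio_mul (hs : (jointCov Q.corr s).PosDef) (α : Finset (Fin p))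
    {z zt : Fin p → ℝ} (hz : ∀ k, z k ∈ (kind k).values) (hzt : ∀ k, zt k ∈ (kind k).values)
    (y : I.Resp B) (j : Fin p) :
    swapRatio P Q s α z zt y j *
      (P.obsDensity I α (Function.update z j (zt j)) y *
        Q.knockoffDensity s I α (Function.update z j (zt j)) (Function.update zt j (z j)) y) =
      P.obsDensity I α z y * Q.knockoffDensity s I α z zt y := by
  have hz' := update_mem_values hz hzt j
  have hzt' := update_mem_values hzt hz j
  unfold swapRatio Params.condDensity
  rw [P.obsDensity_erase_update]
  exact div_mul_div_mul_cancel_of_ne (P.obsDensity_ne_zero (fun k _ => hz k) y)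
    (P.obsDensity_ne_top _ _ y)
    (mul_ne_zero (P.obsDensity_ne_zero (fun k _ => hz' k) y)
      (Params.knockoffDensity_ne_zero hs α hz' hzt' y))
    (ENNReal.mul_ne_top (P.obsDensity_ne_top _ _ y) (Params.knockoffDensity_ne_top hs α hz' y))

/-- At attainable values the ratio is neither `0` nor `∞`, so the conventions of `Real.log` and
`toReal` never intervene. -/
theorem ofReal_exp_log_swapRatio (hs : (jointCov Q.corr s).PosDef) (α : Finset (Fin p))
    {z zt : Fin p → ℝ} (hz : ∀ k, z k ∈ (kind k).values) (hzt : ∀ k, zt k ∈ (kind k).values)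
    (y : I.Resp B) (j : Fin p) :
    ENNReal.ofReal (Real.exp (Real.log (swapRatio P Q s α z zt y j).toReal)) =
      swapRatio P Q s α z zt y j := by
  have hz' := update_mem_values hz hzt j
  have hzt' := update_mem_values hzt hz j
  have h0 (z : Fin p → ℝ) (hz : ∀ k, z k ∈ (kind k).values) : P.condDensity I α j z y ≠ 0 :=
    (ENNReal.div_pos (P.obsDensity_ne_zero (fun k _ => hz k) y) (P.obsDensity_ne_top _ _ y)).ne'
  have ht (z : Fin p → ℝ) (hz : ∀ k, z k ∈ (kind k).values) : P.condDensity I α j z y ≠ ∞ :=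
    ENNReal.div_ne_top (P.obsDensity_ne_top _ _ y) (P.obsDensity_ne_zero (fun k _ => hz k) y)
  have hr0 : swapRatio P Q s α z zt y j ≠ 0 := (ENNReal.div_pos
    (mul_ne_zero (h0 z hz) (Params.knockoffDensity_ne_zero hs α hz hzt y))
    (ENNReal.mul_ne_top (ht _ hz') (Params.knockoffDensity_ne_top hs α hz' y))).ne'
  have hrt : swapRatio P Q s α z zt y j ≠ ∞ := ENNReal.div_ne_top
    (ENNReal.mul_ne_top (ht z hz) (Params.knockoffDensity_ne_top hs α hz y))
    (mul_ne_zero (h0 _ hz') (Params.knockoffDensity_ne_zero hs α hz' hzt' y))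
  rw [Real.exp_log (ENNReal.toReal_pos hr0 hrt), ENNReal.ofReal_toReal hrt]

theorem dataDensity_mask_eq_of_mem (hs : (jointCov Q.corr s).PosDef) (hq : SMAR P.nonNull q)
    {α : Finset (Fin p)} {j : Fin p} (hj : j ∈ α) (hjP : j ∉ P.nonNull)
    {z zt : Fin p → ℝ} (hz : ∀ k, z k ∈ (kind k).values) (hzt : ∀ k, zt k ∈ (kind k).values)
    (y : I.Resp B) :
    dataDensity P Q s q (α, (mask α z, mask α zt), y) =
      swapRatio P Q s α z zt y j *
        dataDensity P Q s q (swapData j (α, (mask α z, mask α zt), y)) := by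
  have h1 : dataDensity P Q s q (α, (mask α z, mask α zt), y) =
      dataDensity P Q s q (α, (z, zt), y) :=
    dataDensity_congr P Q s hq (fun k hk => by simp [mask, hk]) (fun k hk => by simp [mask, hk]) y
  have h2 : dataDensity P Q s q (swapData j (α, (mask α z, mask α zt), y)) =
      dataDensity P Q s q
        (α, (Function.update z j (zt j), Function.update zt j (z j)), y) := by
    refine dataDensity_congr P Q s hq ?_ ?_ y <;>
    · intro k hk
      by_cases hkj : k = j
      · subst hkj; simp [mask, hk]
      · simp [mask, hk, hkj]
  -- Missingness depends on observed non-null predictors only, and `j` is null.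
  have h3 : q (Function.update z j (zt j)) α = q z α := hq α _ _ fun k _ hk => by
    rw [Function.update_of_ne]
    rintro rfl
    exact hjP hk
  rw [h1, h2]
  simp only [dataDensity, h3]
  rw [mul_assoc, ← swapRatio_mul hs α hz hzt y j]
  ring

/-- With a single model, the density of the data times that of the knockoffs is the joint density,
which is exchangeable in `j`. -/
theorem swapRatio_self (hs : (jointCov P.corr s).PosDef) {j : Fin p} (hj : j ∉ P.nonNull)
    (α : Finset (Fin p)) {z zt : Fin p → ℝ} (hz : ∀ k, z k ∈ (kind k).values)
    (hzt : ∀ k, zt k ∈ (kind k).values) (y : I.Resp B) : swapRatio P P s α z zt y j = 1 := by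
  have hz' := update_mem_values hz hzt j
  have hzt' := update_mem_values hzt hz j
  have hmul (z zt : Fin p → ℝ) (hz : ∀ k, z k ∈ (kind k).values) :
      P.obsDensity I α z y * P.knockoffDensity s I α z zt y = P.jointDensity s I α z zt y :=
    ENNReal.mul_div_cancel (P.obsDensity_ne_zero (fun k _ => hz k) y) (P.obsDensity_ne_top _ _ y)
  have h := swapRatio_mul (P := P) hs α hz hzt y j
  rw [hmul _ _ hz, hmul _ _ hz'] at h
  have hswap := P.jointDensity_swapPair hj s α (z, zt) y
  simp only [swapPair] at hswap
  rw [hswap] at h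
  have h0 := P.jointDensity_ne_zero hs (fun k _ => hz k) (fun k _ => hzt k) (α := α) y
  exact (ENNReal.mul_left_inj h0 (P.jointDensity_ne_top hs α z zt y)).mp (h.trans (one_mul _).symm)

end Student

variable {N : ℕ} {B : Fin N → Finset ι} {P Q : Params kind} {s : Fin p → ℝ}
  {q : Fin N → (Fin p → ℝ) → PMF (Finset (Fin p))} {A : Fin N → Finset (Fin p)}
  {z zt : Fin N → Fin p → ℝ} (y : (i : Fin N) → I.Resp (B i)) {j : Fin p}

/-- Students with `j` observed contribute `swapRatio`; for the others the density ignores entry `j`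
and the factor is `1`. -/
theorem prod_dataDensity_eq_exp_klHat_mul (hs : (jointCov Q.corr s).PosDef)
    (hq : ∀ i, SMAR P.nonNull (q i)) (hj : j ∉ P.nonNull)
    (hz : ∀ i k, z i k ∈ (kind k).values) (hzt : ∀ i k, zt i k ∈ (kind k).values) :
    ∏ i, dataDensity P Q s (q i) (A i, (mask (A i) (z i), mask (A i) (zt i)), y i) =
      ENNReal.ofReal (Real.exp (klHat P Q s I B A z zt y j)) *
        ∏ i, dataDensity P Q s (q i)
          (swapData j (A i, (mask (A i) (z i), mask (A i) (zt i)), y i)) := by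
  have hkl : ENNReal.ofReal (Real.exp (klHat P Q s I B A z zt y j)) =
      ∏ i, if j ∈ A i then swapRatio P Q s (A i) (z i) (zt i) (y i) j else 1 := by
    rw [← Finset.prod_filter]
    unfold klHat
    rw [Real.exp_sum, ENNReal.ofReal_prod_of_nonneg fun i _ => (Real.exp_pos _).le]
    exact Finset.prod_congr rfl fun i _ => ofReal_exp_log_swapRatio hs (A i) (hz i) (hzt i) (y i) j
  rw [hkl, ← Finset.prod_mul_distrib]
  refine Finset.prod_congr rfl fun i _ => ?_
  by_cases hi : j ∈ A i
  · rw [if_pos hi, dataDensity_mask_eq_of_mem hs (hq i) hi hj (hz i) (hzt i)]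
  · rw [if_neg hi, one_mul, dataDensity_mask_eq_of_notMem (hq i) hi]

theorem klHat_self (hs : (jointCov P.corr s).PosDef) (hj : j ∉ P.nonNull)
    (hz : ∀ i k, z i k ∈ (kind k).values) (hzt : ∀ i k, zt i k ∈ (kind k).values) :
    klHat P P s I B A z zt y j = 0 := by
  unfold klHat
  refine Finset.sum_eq_zero fun i _ => ?_
  have h := swapRatio_self hs hj (A i) (hz i) (hzt i) (y i)
  unfold swapRatio at h
  rw [h]
  simp

end Model

/-! ### The knockoff statistics on the data space, and the selection bound -/

section Statistics

variable {p N : ℕ} {ι : Type*} {I : Items ι} {B : Fin N → Finset ι}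

/-- The statistics as functions of the data of all students. -/
def dataStatistics
    (w : Fin p → (Fin N → Finset (Fin p)) → (Fin N → Fin p → ℝ) → (Fin N → Fin p → ℝ) →
      ((i : Fin N) → I.Resp (B i)) → ℝ)
    (d : (i : Fin N) → StudentData I (B i) p) (j : Fin p) : ℝ :=
  w j (fun i => (d i).1) (fun i => mask (d i).1 (d i).2.1.1) (fun i => mask (d i).1 (d i).2.1.2)
    fun i => (d i).2.2

variable {w : Fin p → (Fin N → Finset (Fin p)) → (Fin N → Fin p → ℝ) → (Fin N → Fin p → ℝ) →
      ((i : Fin N) → I.Resp (B i)) → ℝ}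

theorem measurable_dataStatistics (hw : ∀ j A y, Measurable
    fun d : (Fin N → Fin p → ℝ) × (Fin N → Fin p → ℝ) => w j A d.1 d.2 y) :
    Measurable (dataStatistics w) := by
  refine measurable_pi_lambda _ fun j => ?_
  have hF : Measurable fun b : ((Fin N → Finset (Fin p)) × ((i : Fin N) → I.Resp (B i))) ×
      ((Fin N → Fin p → ℝ) × (Fin N → Fin p → ℝ)) => w j b.1.1 b.2.1 b.2.2 b.1.2 :=
    measurable_from_prod_countable_right fun c => hw j c.1 c.2
  have hmask : Measurable fun b : Finset (Fin p) × (Fin p → ℝ) => mask b.1 b.2 :=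
    measurable_from_prod_countable_right fun α => measurable_mask α
  have hi (i : Fin N) : Measurable fun d : (i : Fin N) → StudentData I (B i) p => d i :=
    measurable_pi_apply i
  have hG : Measurable fun d : (i : Fin N) → StudentData I (B i) p =>
      (((fun i => (d i).1, fun i => (d i).2.2),
        (fun i => mask (d i).1 (d i).2.1.1, fun i => mask (d i).1 (d i).2.1.2)) :
        ((Fin N → Finset (Fin p)) × ((i : Fin N) → I.Resp (B i))) ×
          ((Fin N → Fin p → ℝ) × (Fin N → Fin p → ℝ))) := by
    refine ((measurable_pi_lambda _ fun i => (hi i).fst).prodMk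
      (measurable_pi_lambda _ fun i => (hi i).snd.snd)).prodMk
      ((measurable_pi_lambda _ fun i => ?_).prodMk (measurable_pi_lambda _ fun i => ?_))
    · exact hmask.comp ((hi i).fst.prodMk (hi i).snd.fst.fst)
    · exact hmask.comp ((hi i).fst.prodMk (hi i).snd.fst.snd)
  exact hF.comp hG

/-- This is the flip-sign property for a single predictor, the only instance that the argument uses.
-/
theorem dataStatistics_swapData (hw : IsKnockoffStatistic w) (j k : Fin p)
    (d : (i : Fin N) → StudentData I (B i) p) :
    dataStatistics w (fun i => swapData j (d i)) k =
      if k = j then -dataStatistics w d k else dataStatistics w d k := by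
  have h := hw k {j} (fun i => (d i).1) (fun i => (d i).2.1.1) (fun i => (d i).2.1.2)
    fun i => (d i).2.2
  simp only [Finset.mem_singleton] at h
  unfold dataStatistics
  rw [← h]
  have hs (z zt : Fin N → Fin p → ℝ) (i : Fin N) :
      swapCols (({j} : Finset (Fin p)) : Set (Fin p)) z zt i =
        Function.update (z i) j (zt i j) := by
    funext l
    by_cases hl : l = j
    · subst hl; simp [swapCols]
    · simp [swapCols, hl]
  simp_rw [hs]
  rfl

end Statistics

theorem lintegral_ncard_selected_le {Ω : Type*} [MeasurableSpace Ω] (μ : Measure Ω) [IsProbabilityMeasure μ]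
    {p N : ℕ} {kind : Fin p → PredictorKind} {ι : Type*}
    (I : Items ι) (B : Fin N → Finset ι)
    (P Q : Params kind)
    (s : Fin p → ℝ) (hs : (jointCov Q.corr s).PosDef)
    (q : Fin N → (Fin p → ℝ) → PMF (Finset (Fin p)))
    (hq_meas : ∀ i α, Measurable fun z => q i z α)
    (hq : ∀ i, SMAR P.nonNull (q i))
    (X : Fin N → Ω → Fin p → ℝ) (Θ : Fin N → Ω → ℝ)
    (Y : (i : Fin N) → Ω → I.Resp (B i)) (A : Fin N → Ω → Finset (Fin p))
    (Xs Xt : Fin N → Ω → Fin p → ℝ)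
    (hdata : IsPlugInKnockoffData μ I B P Q s q X Θ Y A Xs Xt)
    (Z Zt : Fin N → Ω → Fin p → ℝ)
    (hZ : ∀ i ω, Z i ω = P.predictors (X i ω))
    (hZt : ∀ i ω, Zt i ω = Q.predictors (Xt i ω))
    (w : Fin p → (Fin N → Finset (Fin p)) → (Fin N → Fin p → ℝ) → (Fin N → Fin p → ℝ) →
      ((i : Fin N) → I.Resp (B i)) → ℝ)
    (hw_meas : ∀ j A y, Measurable fun d : (Fin N → Fin p → ℝ) × (Fin N → Fin p → ℝ) =>
      w j A d.1 d.2 y)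
    (hw : IsKnockoffStatistic w)
    (W : Ω → Fin p → ℝ)
    (hW : ∀ ω j, W ω j = w j (fun i => A i ω) (fun i => mask (A i ω) (Z i ω))
      (fun i => mask (A i ω) (Zt i ω)) (fun i => Y i ω))
    (KL : Ω → Fin p → ℝ)
    (hKL : ∀ ω j, KL ω j = klHat P Q s I B (fun i => A i ω) (fun i => Z i ω)
      (fun i => Zt i ω) (fun i => Y i ω) j)
    (ν : ℕ) (hν : 1 ≤ ν) (ε : ℝ) :
    ∫⁻ ω, ({j | j ∈ selected ν (W ω) \ P.nonNull ∧ KL ω j ≤ ε}.ncard : ℝ≥0∞) ∂μ ≤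
      ENNReal.ofReal (ν * Real.exp ε) := by
  have hzv : ∀ ω i k, Z i ω k ∈ (kind k).values := fun ω i k => by
    rw [hZ]; exact P.predictors_mem_values _ k
  have hztv : ∀ ω i k, Zt i ω k ∈ (kind k).values := fun ω i k => by
    rw [hZt]; exact Q.predictors_mem_values _ k
  classical
  let d : Ω → (i : Fin N) → StudentData I (B i) p := fun ω i =>
    (A i ω, (mask (A i ω) (Z i ω), mask (A i ω) (Zt i ω)), Y i ω)
  let f : (i : Fin N) → StudentData I (B i) p → ℝ≥0∞ := fun i => dataDensity P Q s (q i)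
  have hf : ∀ i, Measurable (f i) := fun i => measurable_dataDensity P Q s (hq_meas i)
  have hmask : Measurable fun b : Finset (Fin p) × (Fin p → ℝ) => mask b.1 b.2 :=
    measurable_from_prod_countable_right fun α => measurable_mask α
  have hφ : ∀ i, Measurable fun a : (Fin p → ℝ) × ℝ × I.Resp (B i) × Finset (Fin p) ×
      (Fin p → ℝ) × (Fin p → ℝ) => ((a.2.2.2.1, (mask a.2.2.2.1 (P.predictors a.1),
        mask a.2.2.2.1 (Q.predictors a.2.2.2.2.2)), a.2.2.1) : StudentData I (B i) p) := by
    intro i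
    have h1 := hmask.comp (measurable_snd.snd.snd.fst.prodMk
      (P.measurable_predictors.comp measurable_fst) : Measurable
        fun a : (Fin p → ℝ) × ℝ × I.Resp (B i) × Finset (Fin p) × (Fin p → ℝ) × (Fin p → ℝ) =>
          (a.2.2.2.1, P.predictors a.1))
    have h2 := hmask.comp (measurable_snd.snd.snd.fst.prodMk
      (Q.measurable_predictors.comp measurable_snd.snd.snd.snd.snd) : Measurable
        fun a : (Fin p → ℝ) × ℝ × I.Resp (B i) × Finset (Fin p) × (Fin p → ℝ) × (Fin p → ℝ) =>
          (a.2.2.2.1, Q.predictors a.2.2.2.2.2))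
    exact measurable_snd.snd.snd.fst.prodMk ((h1.prodMk h2).prodMk measurable_snd.snd.fst)
  have hdi : ∀ i, (fun ω => d ω i) = fun ω => ((A i ω, (mask (A i ω) (P.predictors (X i ω)),
      mask (A i ω) (Q.predictors (Xt i ω))), Y i ω) : StudentData I (B i) p) := fun i => by
    funext ω
    simp only [d, hZ, hZt]
  have hdm : ∀ i, Measurable fun ω => d ω i := fun i => by
    rw [hdi]
    exact (hφ i).comp ((hdata.measurable_X i).prodMk ((hdata.measurable_Θ i).prodMk
      ((hdata.measurable_Y i).prodMk ((hdata.measurable_A i).prodMk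
        ((hdata.measurable_Xs i).prodMk (hdata.measurable_Xt i))))))
  have hd : Measurable d := measurable_pi_lambda _ hdm
  have hlaw : ∀ i, μ.map (fun ω => d ω i) =
      (dataRefMeasure I (B i) kind).withDensity (f i) := fun i => by
    rw [hdi]
    exact map_studentData μ P Q s (hq_meas i) (hq i) (hdata.measurable_X i)
      (hdata.measurable_Θ i) (hdata.measurable_Y i) (hdata.measurable_A i)
      (hdata.measurable_Xs i) (hdata.measurable_Xt i) (hdata.law_X i) (hdata.law_Θ i)
      (hdata.law_Y i) (hdata.law_A i) (hdata.law_Xs i) (hdata.law_Xt i)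
  have hprob : ∀ i, IsProbabilityMeasure ((dataRefMeasure I (B i) kind).withDensity (f i)) :=
    fun i => by
      rw [← hlaw]
      exact Measure.isProbabilityMeasure_map (hdm i).aemeasurable
  have hind : iIndepFun (fun i ω => d ω i) μ := by
    have h := hdata.indep.comp _ hφ
    have h' : (fun i ω => d ω i) = fun i => (fun a : (Fin p → ℝ) × ℝ × I.Resp (B i) ×
        Finset (Fin p) × (Fin p → ℝ) × (Fin p → ℝ) => ((a.2.2.2.1,
          (mask a.2.2.2.1 (P.predictors a.1), mask a.2.2.2.1 (Q.predictors a.2.2.2.2.2)),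
            a.2.2.1) : StudentData I (B i) p)) ∘
        fun ω => (X i ω, Θ i ω, Y i ω, A i ω, Xs i ω, Xt i ω) := funext hdi
    rw [h']
    exact h
  have hjoint : μ.map d =
      Measure.pi fun i => (dataRefMeasure I (B i) kind).withDensity (f i) := by
    simp_rw [← hlaw]
    exact (iIndepFun_iff_map_fun_eq_pi_map fun i => (hdm i).aemeasurable).mp hind
  have hWm := measurable_dataStatistics hw_meas
  have hWd : ∀ ω, dataStatistics w (d ω) = W ω := fun ω => by
    funext j
    rw [hW]
    simp only [dataStatistics, d, mask_mask]
  let T : Fin p → Set ((i : Fin N) → StudentData I (B i) p) := fun j =>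
    {e | dataStatistics w e j < 0 ∧ ExceedsThreshold ν (dataStatistics w e) j}
  -- The bound on the divergence enters as an inequality between likelihoods. This is a measurable
  -- condition on the data, and exactly what the change of measure requires.
  let S : Fin p → Set ((i : Fin N) → StudentData I (B i) p) := fun j =>
    {e | (0 < dataStatistics w e j ∧ ExceedsThreshold ν (dataStatistics w e) j) ∧
      ∏ i, f i (e i) ≤ ENNReal.ofReal (Real.exp ε) * ∏ i, f i (swapData j (e i))}
  have hWj : ∀ j, Measurable fun e => dataStatistics w e j := fun j =>
    (measurable_pi_apply j).comp hWm
  have habs : ∀ j, Measurable fun e => |dataStatistics w e j| := fun j => (hWj j).abs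
  have hex : ∀ j, MeasurableSet {e | ExceedsThreshold ν (dataStatistics w e) j} := fun j => by
    refine measurableSet_threshold_lt hν (measurable_pi_lambda _ fun k => ?_) (habs j)
    by_cases hk : k = j
    · subst hk; simpa using habs k
    · simpa [hk] using hWj k
  have hTm : ∀ j, MeasurableSet (T j) := fun j =>
    (measurableSet_lt (hWj j) measurable_const).inter (hex j)
  have hsw : ∀ j i, MeasurePreserving (swapData j)
      (dataRefMeasure I (B i) kind) (dataRefMeasure I (B i) kind) :=
    fun j i => measurePreserving_swapData j
  have hSm : ∀ j, MeasurableSet (S j) := fun j => by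
    have h1 : Measurable fun e : (i : Fin N) → StudentData I (B i) p => ∏ i, f i (e i) :=
      Finset.measurable_prod _ fun i _ => (hf i).comp (measurable_pi_apply i)
    have h2 : Measurable fun e : (i : Fin N) → StudentData I (B i) p =>
        ∏ i, f i (swapData j (e i)) := Finset.measurable_prod _ fun i _ =>
      ((hf i).comp (hsw j i).measurable).comp (measurable_pi_apply i)
    exact ((measurableSet_lt measurable_const (hWj j)).inter (hex j)).inter
      (measurableSet_le h1 (h2.const_mul _))
  -- The exchange at `j` maps `S j` into `T j`: the sign of the statistic flips and the modified
  -- threshold stays.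
  have hST : ∀ j, μ (d ⁻¹' S j) ≤ ENNReal.ofReal (Real.exp ε) * μ (d ⁻¹' T j) := fun j => by
    rw [← Measure.map_apply hd (hSm j), ← Measure.map_apply hd (hTm j), hjoint]
    refine pi_withDensity_le_of_measurePreserving _ hf (hsw j) (hSm j) (hTm j)
      ENNReal.ofReal_ne_top fun e he => ⟨⟨?_, ?_⟩, he.2⟩
    · rw [dataStatistics_swapData hw, if_pos rfl]
      exact neg_lt_zero.mpr he.1.1
    · refine (exceedsThreshold_neg_iff ?_ fun k hk => ?_).mpr he.1.2
      · rw [dataStatistics_swapData hw, if_pos rfl]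
      · rw [dataStatistics_swapData hw, if_neg hk]
  have hmem : ∀ ω j, j ∈ selected ν (W ω) \ P.nonNull → KL ω j ≤ ε → ω ∈ d ⁻¹' S j := by
    intro ω j hj hkl
    refine ⟨?_, ?_⟩
    · rw [hWd]
      exact pos_and_exceedsThreshold_of_mem_selected hj.1
    · refine (prod_dataDensity_eq_exp_klHat_mul (fun i => Y i ω) hs hq hj.2 (hzv ω)
        (hztv ω)).trans_le ?_
      rw [← hKL]
      gcongr
  calc ∫⁻ ω, ({j | j ∈ selected ν (W ω) \ P.nonNull ∧ KL ω j ≤ ε}.ncard : ℝ≥0∞) ∂μ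
      ≤ ∫⁻ ω, ∑ j, (d ⁻¹' S j).indicator 1 ω ∂μ := by
        refine lintegral_mono fun ω => ?_
        have h1 : {j | j ∈ selected ν (W ω) \ P.nonNull ∧ KL ω j ≤ ε}.ncard ≤
            (Finset.univ.filter fun j => ω ∈ d ⁻¹' S j).card := by
          rw [← Set.ncard_coe_finset]
          refine Set.ncard_le_ncard (fun j hj => ?_) (Finset.finite_toSet _)
          simpa using hmem ω j hj.1 hj.2
        refine (Nat.cast_le.mpr h1).trans_eq ?_
        rw [Finset.natCast_card_filter]
        simp only [Set.indicator_apply, Pi.one_apply]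
    _ = ∑ j, μ (d ⁻¹' S j) := by
        rw [lintegral_finsetSum _ fun j _ => measurable_one.indicator (hd (hSm j))]
        simp_rw [lintegral_indicator_one (hd (hSm _))]
    _ ≤ ∑ j, ENNReal.ofReal (Real.exp ε) * μ (d ⁻¹' T j) :=
        Finset.sum_le_sum fun j _ => hST j
    _ = ENNReal.ofReal (Real.exp ε) * ∫⁻ ω, ∑ j, (d ⁻¹' T j).indicator 1 ω ∂μ := by
        rw [lintegral_finsetSum _ fun j _ => measurable_one.indicator (hd (hTm j)),
          Finset.mul_sum]
        simp_rw [lintegral_indicator_one (hd (hTm _))]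
    -- Here the sum runs over all predictors, null or not; the counting bound is pointwise.
    _ ≤ ENNReal.ofReal (Real.exp ε) * ∫⁻ _, ν ∂μ := by
        gcongr with ω
        have h1 := card_neg_and_exceedsThreshold_le hν (dataStatistics w (d ω))
        refine le_trans (le_of_eq ?_) (Nat.cast_le.mpr h1)
        rw [Finset.natCast_card_filter]
        refine Finset.sum_congr rfl fun j _ => ?_
        rw [Set.indicator_apply]
        exact if_congr Iff.rfl rfl rfl
    _ = ENNReal.ofReal (ν * Real.exp ε) := by
        rw [lintegral_const, measure_univ, mul_one, mul_comm (ν : ℝ),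
          ENNReal.ofReal_mul (Real.exp_pos _).le, ENNReal.ofReal_natCast]

end KnockoffIRT

end

theorem theorem1 {Ω : Type*} [MeasurableSpace Ω] (μ : Measure Ω) [IsProbabilityMeasure μ]
    {p N : ℕ} {kind : Fin p → KnockoffIRT.PredictorKind} {ι : Type*}
    (I : KnockoffIRT.Items ι) (B : Fin N → Finset ι)
    (P Q : KnockoffIRT.Params kind)
    (s : Fin p → ℝ) (hs : (KnockoffIRT.jointCov Q.corr s).PosDef)
    (q : Fin N → (Fin p → ℝ) → PMF (Finset (Fin p)))
    (hq_meas : ∀ i α, Measurable fun z => q i z α)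
    (hq : ∀ i, KnockoffIRT.SMAR P.nonNull (q i))
    (X : Fin N → Ω → Fin p → ℝ) (Θ : Fin N → Ω → ℝ)
    (Y : (i : Fin N) → Ω → I.Resp (B i)) (A : Fin N → Ω → Finset (Fin p))
    (Xs Xt : Fin N → Ω → Fin p → ℝ)
    (hdata : KnockoffIRT.IsPlugInKnockoffData μ I B P Q s q X Θ Y A Xs Xt)
    (Z Zt : Fin N → Ω → Fin p → ℝ)
    (hZ : ∀ i ω, Z i ω = P.predictors (X i ω))
    (hZt : ∀ i ω, Zt i ω = Q.predictors (Xt i ω))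
    (w : Fin p → (Fin N → Finset (Fin p)) → (Fin N → Fin p → ℝ) → (Fin N → Fin p → ℝ) →
      ((i : Fin N) → I.Resp (B i)) → ℝ)
    (hw_meas : ∀ j A y, Measurable fun d : (Fin N → Fin p → ℝ) × (Fin N → Fin p → ℝ) =>
      w j A d.1 d.2 y)
    (hw : KnockoffIRT.IsKnockoffStatistic w)
    (W : Ω → Fin p → ℝ)
    (hW : ∀ ω j, W ω j = w j (fun i => A i ω) (fun i => KnockoffIRT.mask (A i ω) (Z i ω))
      (fun i => KnockoffIRT.mask (A i ω) (Zt i ω)) (fun i => Y i ω))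
    (KL : Ω → Fin p → ℝ)
    (hKL : ∀ ω j, KL ω j = KnockoffIRT.klHat P Q s I B (fun i => A i ω) (fun i => Z i ω)
      (fun i => Zt i ω) (fun i => Y i ω) j)
    (ν : ℕ) (hν : 1 ≤ ν) :
    (∀ ε : ℝ, 0 ≤ ε →
      ∫⁻ ω, ({j | j ∈ KnockoffIRT.selected ν (W ω) \ P.nonNull ∧ KL ω j ≤ ε}.ncard : ℝ≥0∞) ∂μ ≤
        ENNReal.ofReal (ν * Real.exp ε)) ∧
    (Q = P → ∀ j, j ∉ P.nonNull → ∀ ω, KL ω j = 0) := by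
  refine ⟨fun ε _ => KnockoffIRT.lintegral_ncard_selected_le μ I B P Q s hs q hq_meas hq X Θ Y A
    Xs Xt hdata Z Zt hZ hZt w hw_meas hw W hW KL hKL ν hν ε, ?_⟩
  rintro rfl j hj ω
  rw [hKL]
  refine KnockoffIRT.klHat_self _ hs hj (fun i k => ?_) fun i k => ?_
  · rw [hZ]; exact Q.predictors_mem_values _ k
  · rw [hZt]; exact Q.predictors_mem_values _ k
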